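/- Let $d\ge 2$, let $\theta$ be a real skew-symmetric $d\times d$ matrix, and let $\mathbb{T}^d_\theta$ be the quantum torus: the von Neumann algebra generated, in the GNS representation of the trace $\tau$, by unitaries $U_1,\dots,U_d$ with $U_kU_j=e^{2\pi i\theta_{kj}}U_jU_k$, where $\tau\big(\sum_m\alpha_mU^m\big)=\alpha_0$ and $U^m=U_1^{m_1}\cdots U_d^{m_d}$. Let $L_p(\mathbb{T}^d_\theta)$ be its noncommutative $L_p$-spaces, with norm $\|\cdot\|_p$: for $p<\infty$ the completion of $\mathbb{T}^d_\theta$ for $\|x\|_p=\tau(|x|^p)^{1/p}$, and $L_\infty(\mathbb{T}^d_\theta)=\mathbb{T}^d_\theta$ with the operator norm. Let $\mathcal{S}(\mathbb{T}^d_\theta)$ be the space of all $\sum_m a_mU^m$ with $(a_m)_{m\in\mathbb{Z}^d}$ rapidly decreasing, with derivations $\partial_j(U^n)=2\pi i\,n_jU^n$, with $D^m=\partial_1^{m_1}\cdots\partial_d^{m_d}$ for $m\in\mathbb{N}_0^d$, and with the topology of the norms $\sup_{|m|_1\le k}\|D^mx\|_\infty$, $k\ge0$. Let $\mathcal{S}'(\mathbb{T}^d_\theta)$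 be the space of continuous linear functionals on $\mathcal{S}(\mathbb{T}^d_\theta)$ (distributions), with $\langle D^mx,a\rangle=(-1)^{|m|_1}\langle x,D^ma\rangle$ and $\widehat{x}(n)=\langle x,(U^n)^*\rangle$; each $y\in L_p(\mathbb{T}^d_\theta)$ is identified with the distribution $a\mapsto\tau(ya)$. For $1\le p\le\infty$ and an integer $k\ge0$ put $$W^k_p(\mathbb{T}^d_\theta)=\{x\in\mathcal{S}'(\mathbb{T}^d_\theta): D^mx\in L_p(\mathbb{T}^d_\theta)\text{ for all }|m|_1\le k\},$$ $$\|x\|_{W^k_p}=\Big(\sum_{|m|_1\le k}\|D^mx\|_p^p\Big)^{1/p},\qquad |x|_{W^k_p}=\Big(\sum_{|m|_1=k}\|D^mx\|_p^p\Big)^{1/p},$$ with maxima instead of sums for $p=\infty$. Theorem (Poincaré-type inequality). (1) There is a constant $C$ depending only on $d$ such that, for all $\theta$, all $1\le p\le\infty$ and all $x\in W^1_p(\mathbb{T}^d_\theta)$, $$\|x-\widehat{x}(0)\|_p\le C\,|x|_{W^1_p}.$$ (2) For all integers $0\le j<k$ there is a constant $C$ depending only on $d,j,k$ such that, for all $\theta$,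 all $1\le p\le\infty$ and all $x\in W^k_p(\mathbb{T}^d_\theta)$ with $\widehat{x}(0)=0$, $$|x|_{W^j_p}\le C\,|x|_{W^k_p}.$$ (3) For every integer $k\ge1$, every $\theta$ and every $1\le p\le\infty$, $W^k_p(\mathbb{T}^d_\theta)$ is a linear space on which $x\mapsto|\widehat{x}(0)|+|x|_{W^k_p}$ is a norm, and this norm is equivalent to $\|\cdot\|_{W^k_p}$: there is a constant $C$ depending only on $d,k$ such that, for all $x\in W^k_p(\mathbb{T}^d_\theta)$, $$|\widehat{x}(0)|+|x|_{W^k_p}\le C\,\|x\|_{W^k_p}\quad\text{and}\quad\|x\|_{W^k_p}\le C\,\big(|\widehat{x}(0)|+|x|_{W^k_p}\big).$$ -/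

import Mathlib

open Filter Topology
open scoped ENNReal NNReal InnerProductSpace Matrix

namespace QuantumTorus

noncomputable section

/-! ### The quantum torus -/

/-- The Hilbert space `ℓ²(ℤ^d)`: the GNS space of the trace on polynomials in `U_1, …, U_d`, the
basis vector `e_n` being the class of `U^n = U_1^{n_1} ⋯ U_d^{n_d}`. -/
def Hilb (d : ℕ) : Type := lp (fun _ : Fin d → ℤ => ℂ) 2

instance (d : ℕ) : NormedAddCommGroup (Hilb d) :=
  inferInstanceAs (NormedAddCommGroup (lp (fun _ : Fin d → ℤ => ℂ) 2))

instance (d : ℕ) : InnerProductSpace ℂ (Hilb d) :=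
  inferInstanceAs (InnerProductSpace ℂ (lp (fun _ : Fin d → ℤ => ℂ) 2))

instance (d : ℕ) : CompleteSpace (Hilb d) :=
  inferInstanceAs (CompleteSpace (lp (fun _ : Fin d → ℤ => ℂ) 2))

/-- The coordinates of a vector of `ℓ²(ℤ^d)`. -/
instance (d : ℕ) : CoeFun (Hilb d) (fun _ => (Fin d → ℤ) → ℂ) :=
  ⟨fun f => Subtype.val (p := fun g => g ∈ lp (fun _ : Fin d → ℤ => ℂ) 2) f⟩

theorem Hilb.ext {d : ℕ} {f g : Hilb d} (h : ∀ k, f k = g k) : f = g :=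
  Subtype.ext (funext h)

theorem Hilb.add_apply {d : ℕ} (f g : Hilb d) (k : Fin d → ℤ) : (f + g) k = f k + g k := rfl

theorem Hilb.smul_apply {d : ℕ} (c : ℂ) (f : Hilb d) (k : Fin d → ℤ) : (c • f) k = c * f k := rfl

theorem Hilb.norm_eq {d : ℕ} (f : Hilb d) :
    ‖f‖ = (∑' k, ‖f k‖ ^ (2 : ℝ)) ^ (1 / (2 : ℝ)) := by
  have h := lp.norm_eq_tsum_rpow (p := 2) (by norm_num)
    (show lp (fun _ : Fin d → ℤ => ℂ) 2 from f)
  simp only [ENNReal.toReal_ofNat] at h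
  exact h

theorem Hilb.inner_eq {d : ℕ} (f g : Hilb d) : ⟪f, g⟫_ℂ = ∑' k, (starRingEnd ℂ) (f k) * g k := by
  refine (lp.inner_eq_tsum (𝕜 := ℂ) (show lp (fun _ : Fin d → ℤ => ℂ) 2 from f)
    (show lp (fun _ : Fin d → ℤ => ℂ) 2 from g)).trans (tsum_congr fun k => ?_)
  exact mul_comm _ _

/-- Bounded operators on the GNS space. -/
abbrev Op (d : ℕ) : Type := Hilb d →L[ℂ] Hilb d

/-- The basis vector `e_n`. -/
def basisVec {d : ℕ} (n : Fin d → ℤ) : Hilb d :=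
  (lp.single 2 n (1 : ℂ) : lp (fun _ : Fin d → ℤ => ℂ) 2)

theorem basisVec_apply {d : ℕ} (n k : Fin d → ℤ) :
    (basisVec n) k = if k = n then 1 else 0 := by
  change (lp.single 2 n (1 : ℂ) : lp (fun _ : Fin d → ℤ => ℂ) 2) k = _
  rw [lp.single_apply, Pi.single_apply]

/-- The scalar `c(n,k)` in `U^n U^k = c(n,k) U^{n+k}`, namely
`exp (2πi ∑_{j<i} θ_{ij} n_i k_j)`, obtained by commuting `U_j^{k_j}` to the left of the
`U_i^{n_i}` with `i > j`. -/
def cocycle {d : ℕ} (θ : Matrix (Fin d) (Fin d) ℝ) (n k : Fin d → ℤ) : ℂ :=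
  Complex.exp (2 * Real.pi * Complex.I *
    ∑ i, ∑ j, if j < i then (θ i j : ℂ) * (n i : ℂ) * (k j : ℂ) else 0)

theorem norm_cocycle {d : ℕ} (θ : Matrix (Fin d) (Fin d) ℝ) (n k : Fin d → ℤ) :
    ‖cocycle θ n k‖ = 1 := by
  have h : (2 * Real.pi * Complex.I *
      ∑ i, ∑ j, if j < i then (θ i j : ℂ) * (n i : ℂ) * (k j : ℂ) else 0 : ℂ) =
      ((2 * Real.pi * ∑ i, ∑ j, if j < i then θ i j * (n i : ℝ) * (k j : ℝ) else 0 : ℝ) : ℂ)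
        * Complex.I := by
    push_cast [apply_ite]
    ring
  rw [cocycle, h, Complex.norm_exp_ofReal_mul_I]

theorem cocycle_add_left {d : ℕ} (θ : Matrix (Fin d) (Fin d) ℝ) (n m k : Fin d → ℤ) :
    cocycle θ (n + m) k = cocycle θ n k * cocycle θ m k := by
  rw [cocycle, cocycle, cocycle, ← Complex.exp_add, ← mul_add, ← Finset.sum_add_distrib]
  congr 2
  refine Finset.sum_congr rfl fun i _ => ?_
  rw [← Finset.sum_add_distrib]
  refine Finset.sum_congr rfl fun j _ => ?_
  split_ifs
  · simp only [Pi.add_apply, Int.cast_add]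
    ring
  · rw [add_zero]

theorem cocycle_add_right {d : ℕ} (θ : Matrix (Fin d) (Fin d) ℝ) (n m k : Fin d → ℤ) :
    cocycle θ n (m + k) = cocycle θ n m * cocycle θ n k := by
  rw [cocycle, cocycle, cocycle, ← Complex.exp_add, ← mul_add, ← Finset.sum_add_distrib]
  congr 2
  refine Finset.sum_congr rfl fun i _ => ?_
  rw [← Finset.sum_add_distrib]
  refine Finset.sum_congr rfl fun j _ => ?_
  split_ifs
  · simp only [Pi.add_apply, Int.cast_add]
    ring
  · rw [add_zero]

theorem cocycle_zero_left {d : ℕ} (θ : Matrix (Fin d) (Fin d) ℝ) (k : Fin d → ℤ) :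
    cocycle θ 0 k = 1 := by simp [cocycle]

theorem cocycle_zero_right {d : ℕ} (θ : Matrix (Fin d) (Fin d) ℝ) (k : Fin d → ℤ) :
    cocycle θ k 0 = 1 := by simp [cocycle]

theorem cocycle_neg_neg {d : ℕ} (θ : Matrix (Fin d) (Fin d) ℝ) (n k : Fin d → ℤ) :
    cocycle θ (-n) (-k) = cocycle θ n k := by simp [cocycle]

theorem memLp_shift {d : ℕ} (θ : Matrix (Fin d) (Fin d) ℝ) (n : Fin d → ℤ) (f : Hilb d) :
    Memℓp (fun k : Fin d → ℤ => cocycle θ n (k - n) * f (k - n)) 2 := by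
  have h := (memℓp_gen_iff (p := 2) (by norm_num)).1 f.2
  refine (memℓp_gen_iff (p := 2) (by norm_num)).2 ?_
  have h2 := (Equiv.subRight n).summable_iff.2 h
  refine h2.congr fun k => ?_
  rw [norm_mul, norm_cocycle, one_mul]
  rfl

/-- The monomial `U^n`, as a linear map: `U^n e_k = c(n,k) e_{n+k}`. -/
def monoLin {d : ℕ} (θ : Matrix (Fin d) (Fin d) ℝ) (n : Fin d → ℤ) : Hilb d →ₗ[ℂ] Hilb d where
  toFun f := ⟨fun k => cocycle θ n (k - n) * f (k - n), memLp_shift θ n f⟩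
  map_add' f g := Hilb.ext fun k => mul_add _ (f (k - n)) (g (k - n))
  map_smul' c f := Hilb.ext fun k => mul_left_comm _ c (f (k - n))

theorem norm_monoLin {d : ℕ} (θ : Matrix (Fin d) (Fin d) ℝ) (n : Fin d → ℤ) (f : Hilb d) :
    ‖monoLin θ n f‖ = ‖f‖ := by
  rw [Hilb.norm_eq, Hilb.norm_eq]
  congr 1
  rw [← (Equiv.subRight n).tsum_eq (fun k => ‖f k‖ ^ (2 : ℝ))]
  refine tsum_congr fun k => ?_
  change ‖cocycle θ n (k - n) * f (k - n)‖ ^ (2 : ℝ) = ‖f (k - n)‖ ^ (2 : ℝ)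
  rw [norm_mul, norm_cocycle, one_mul]

/-- The monomial `U^n = U_1^{n_1} ⋯ U_d^{n_d}` acting on the GNS space:
`U^n e_k = c(n,k) e_{n+k}`. -/
def mono {d : ℕ} (θ : Matrix (Fin d) (Fin d) ℝ) (n : Fin d → ℤ) : Op d :=
  (monoLin θ n).mkContinuous 1 fun f => by rw [norm_monoLin, one_mul]

theorem mono_apply {d : ℕ} (θ : Matrix (Fin d) (Fin d) ℝ) (n : Fin d → ℤ) (f : Hilb d)
    (k : Fin d → ℤ) : mono θ n f k = cocycle θ n (k - n) * f (k - n) := rfl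

theorem mono_basisVec {d : ℕ} (θ : Matrix (Fin d) (Fin d) ℝ) (n k : Fin d → ℤ) :
    mono θ n (basisVec k) = cocycle θ n k • basisVec (n + k) := by
  refine Hilb.ext fun l => ?_
  rw [mono_apply, Hilb.smul_apply, basisVec_apply, basisVec_apply]
  by_cases h : l = n + k
  · simp [h]
  · have h' : l - n ≠ k := fun h' => h (by rw [← h']; abel)
    simp [h, h']

theorem mono_zero {d : ℕ} (θ : Matrix (Fin d) (Fin d) ℝ) : mono θ 0 = 1 := by
  refine ContinuousLinearMap.ext fun f => Hilb.ext fun k => ?_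
  rw [mono_apply, cocycle_zero_left, sub_zero, one_mul, one_apply_eq_self]

theorem mono_mul {d : ℕ} (θ : Matrix (Fin d) (Fin d) ℝ) (n k : Fin d → ℤ) :
    mono θ n * mono θ k = cocycle θ n k • mono θ (n + k) := by
  refine ContinuousLinearMap.ext fun f => Hilb.ext fun l => ?_
  change mono θ n (mono θ k f) l = cocycle θ n k * mono θ (n + k) f l
  rw [mono_apply, mono_apply, mono_apply, cocycle_add_left]
  have h1 : l - n - k = l - (n + k) := by abel
  have h2 : l - n = k + (l - (n + k)) := by abel
  rw [h1, h2, cocycle_add_right]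
  ring

theorem norm_mono_apply {d : ℕ} (θ : Matrix (Fin d) (Fin d) ℝ) (n : Fin d → ℤ) (f : Hilb d) :
    ‖mono θ n f‖ = ‖f‖ := norm_monoLin θ n f

theorem norm_mono_le {d : ℕ} (θ : Matrix (Fin d) (Fin d) ℝ) (n : Fin d → ℤ) :
    ‖mono θ n‖ ≤ 1 :=
  LinearMap.mkContinuous_norm_le _ zero_le_one _

/-- `(U^n)^* = conj (c(n,-n)) U^{-n}`. -/
theorem star_mono {d : ℕ} (θ : Matrix (Fin d) (Fin d) ℝ) (n : Fin d → ℤ) :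
    star (mono θ n) = (starRingEnd ℂ) (cocycle θ n (-n)) • mono θ (-n) := by
  have h1 : star (mono θ n) * mono θ n = 1 := by
    rw [ContinuousLinearMap.star_eq_adjoint]
    exact (ContinuousLinearMap.norm_map_iff_adjoint_comp_self _).1 (norm_mono_apply θ n)
  have h2 : mono θ n * ((starRingEnd ℂ) (cocycle θ n (-n)) • mono θ (-n)) = 1 := by
    rw [mul_smul_comm, mono_mul, smul_smul, add_neg_cancel, mono_zero, ← Complex.normSq_eq_conj_mul_self,
      Complex.normSq_eq_norm_sq, norm_cocycle]
    simp
  exact left_inv_eq_right_inv h1 h2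

theorem mono_mem_unitary {d : ℕ} (θ : Matrix (Fin d) (Fin d) ℝ) (n : Fin d → ℤ) :
    mono θ n ∈ unitary (Op d) := by
  have h1 : star (mono θ n) * mono θ n = 1 := by
    rw [ContinuousLinearMap.star_eq_adjoint]
    exact (ContinuousLinearMap.norm_map_iff_adjoint_comp_self _).1 (norm_mono_apply θ n)
  refine Unitary.mem_iff.2 ⟨h1, ?_⟩
  rw [star_mono, mul_smul_comm, mono_mul, smul_smul, add_neg_cancel, mono_zero,
    ← Complex.normSq_eq_conj_mul_self, Complex.normSq_eq_norm_sq, norm_cocycle]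
  simp

/-- The generators `U_1, …, U_d`. -/
def gen {d : ℕ} (θ : Matrix (Fin d) (Fin d) ℝ) (j : Fin d) : unitary (Op d) :=
  ⟨mono θ (Pi.single j 1), mono_mem_unitary θ _⟩

/-- `U_k U_j = e^{2πi θ_{kj}} U_j U_k`. -/
theorem gen_commutation {d : ℕ} (θ : Matrix (Fin d) (Fin d) ℝ) (hθ : θᵀ = -θ) (k j : Fin d) :
    (gen θ k : Op d) * (gen θ j : Op d) =
      Complex.exp (2 * Real.pi * Complex.I * (θ k j : ℂ)) • ((gen θ j : Op d) * (gen θ k : Op d)) := by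
  have hc : ∀ a b : Fin d, cocycle θ (Pi.single a 1) (Pi.single b 1) =
      Complex.exp (2 * Real.pi * Complex.I * if b < a then (θ a b : ℂ) else 0) := by
    intro a b
    rw [cocycle]
    congr 2
    rw [Finset.sum_eq_single a, Finset.sum_eq_single b]
    · simp
    · intro i _ hi
      simp [hi]
    · simp
    · intro i _ hi
      simp [hi]
    · simp
  have hs : ∀ a b : Fin d, θ a b = - θ b a := fun a b => congrFun (congrFun hθ b) a
  simp only [gen, mono_mul, smul_smul, hc]
  have hadd : (Pi.single j (1 : ℤ) + Pi.single k 1 : Fin d → ℤ) = Pi.single k 1 + Pi.single j 1 :=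
    add_comm _ _
  rw [hadd, ← Complex.exp_add, ← mul_add]
  congr 3
  rcases lt_trichotomy j k with h | h | h
  · simp [h, h.not_gt]
  · subst h
    have : θ j j = 0 := by linarith [hs j j]
    simp [this]
  · rw [if_neg h.not_gt, if_pos h, hs k j]
    push_cast
    ring

theorem mono_single_zpow {d : ℕ} (θ : Matrix (Fin d) (Fin d) ℝ) (j : Fin d) (a : ℤ) :
    ((gen θ j ^ a : unitary (Op d)) : Op d) = mono θ (Pi.single j a) := by
  have hc : ∀ b c : ℤ, cocycle θ (Pi.single j b) (Pi.single j c) = 1 := by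
    intro b c
    rw [cocycle, Finset.sum_eq_zero, mul_zero, Complex.exp_zero]
    intro i _
    refine Finset.sum_eq_zero fun l _ => ?_
    split_ifs with h
    · by_cases hi : i = j
      · have : l ≠ j := by rw [← hi]; exact h.ne
        simp [this]
      · simp [hi]
    · rfl
  have hu : ∀ b : ℤ, (⟨mono θ (Pi.single j b), mono_mem_unitary θ _⟩ : unitary (Op d)) * gen θ j =
      ⟨mono θ (Pi.single j (b + 1)), mono_mem_unitary θ _⟩ := by
    intro b
    apply Subtype.ext
    change mono θ (Pi.single j b) * mono θ (Pi.single j 1) = mono θ (Pi.single j (b + 1))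
    rw [mono_mul, hc, one_smul, Pi.single_add]
  have key : ∀ b : ℤ, gen θ j ^ b =
      (⟨mono θ (Pi.single j b), mono_mem_unitary θ _⟩ : unitary (Op d)) := by
    intro b
    induction b using Int.induction_on with
    | zero =>
      apply Subtype.ext
      simp [mono_zero]
    | succ n ih => rw [zpow_add_one, ih, hu]
    | pred n ih =>
      rw [zpow_sub_one, ih, ← sub_add_cancel (-(n : ℤ)) 1, ← hu]
      simp
  rw [key]

/-- `U^n` is the ordered product `U_1^{n_1} ⋯ U_d^{n_d}`. -/
theorem mono_eq_prod {d : ℕ} (θ : Matrix (Fin d) (Fin d) ℝ) (n : Fin d → ℤ) :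
    mono θ n = (((List.ofFn fun j => gen θ j ^ n j).prod : unitary (Op d)) : Op d) := by
  have key : ∀ (r : ℕ) (hr : r ≤ d),
      (((List.ofFn fun j : Fin r => gen θ (Fin.castLE hr j) ^ n (Fin.castLE hr j)).prod :
        unitary (Op d)) : Op d) = mono θ (fun i => if (i : ℕ) < r then n i else 0) := by
    intro r
    induction r with
    | zero =>
      intro hr
      have : (fun i : Fin d => if (i : ℕ) < 0 then n i else 0) = 0 := by ext i; simp
      rw [this, mono_zero]
      simp
    | succ r ih =>
      intro hr
      rw [List.ofFn_succ', List.concat_eq_append, List.prod_append, List.prod_singleton,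
        Submonoid.coe_mul, mono_single_zpow]
      have h0 := ih (Nat.le_of_succ_le hr)
      have hcast : ∀ j : Fin r, Fin.castLE hr j.castSucc = Fin.castLE (Nat.le_of_succ_le hr) j :=
        fun j => rfl
      simp only [hcast]
      rw [h0, mono_mul]
      have hc : cocycle θ (fun i => if (i : ℕ) < r then n i else 0)
          (Pi.single (Fin.castLE hr (Fin.last r)) (n (Fin.castLE hr (Fin.last r)))) = 1 := by
        rw [cocycle, Finset.sum_eq_zero, mul_zero, Complex.exp_zero]
        intro i _
        refine Finset.sum_eq_zero fun l _ => ?_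
        split_ifs with h1 h2
        · have : l ≠ Fin.castLE hr (Fin.last r) := by
            intro hl
            have h3 : (l : ℕ) = r := by rw [hl]; simp
            have h4 : (l : ℕ) < i := h1
            omega
          simp [this]
        · simp
        · rfl
      rw [hc, one_smul]
      congr 1
      ext i
      by_cases hi : i = Fin.castLE hr (Fin.last r)
      · subst hi
        simp
      · have hne : (i : ℕ) ≠ r := fun h => hi (Fin.ext (by simpa using h))
        have hiff : (i : ℕ) < r + 1 ↔ (i : ℕ) < r := by omega
        simp [hi, hiff]
  have h := key d le_rfl
  simp only [Fin.castLE_rfl, Fin.is_lt, if_true] at h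
  exact h.symm

/-- The quantum torus `𝕋^d_θ`: the von Neumann algebra generated by `U_1, …, U_d` in the GNS
representation, i.e. the bicommutant of `{U_1, …, U_d}` and their adjoints. -/
def torus {d : ℕ} (θ : Matrix (Fin d) (Fin d) ℝ) : VonNeumannAlgebra (Hilb d) where
  toStarSubalgebra := StarSubalgebra.centralizer ℂ
    (Set.centralizer (Set.range (fun j => (gen θ j : Op d)) ∪
      star (Set.range fun j => (gen θ j : Op d))))
  centralizer_centralizer' := by
    have h : star (Set.centralizer (Set.range (fun j => (gen θ j : Op d)) ∪
        star (Set.range fun j => (gen θ j : Op d)))) =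
        Set.centralizer (Set.range (fun j => (gen θ j : Op d)) ∪
          star (Set.range fun j => (gen θ j : Op d))) := by
      ext x
      rw [Set.mem_star]
      exact ⟨fun hx => by simpa using Set.star_mem_centralizer hx, Set.star_mem_centralizer⟩
    change Set.centralizer (Set.centralizer (Set.centralizer _)) = Set.centralizer _
    rw [h, Set.union_self, Set.centralizer_centralizer_centralizer]

/-- The trace `τ(x) = ⟨e_0, x e_0⟩`; thus `τ(∑ α_m U^m) = α_0`. -/
def trace {d : ℕ} (x : Op d) : ℂ := ⟪basisVec 0, x (basisVec 0)⟫_ℂ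

theorem trace_mono {d : ℕ} (θ : Matrix (Fin d) (Fin d) ℝ) (n : Fin d → ℤ) :
    trace (mono θ n) = if n = 0 then 1 else 0 := by
  rw [trace, mono_basisVec, cocycle_zero_right, one_smul, add_zero, Hilb.inner_eq,
    tsum_eq_single 0 (fun k hk => by rw [basisVec_apply, if_neg hk, map_zero, zero_mul]),
    basisVec_apply, basisVec_apply]
  simp [eq_comm]

theorem norm_trace_le {d : ℕ} (x : Op d) : ‖trace x‖ ≤ ‖x‖ := by
  have h : ‖(basisVec 0 : Hilb d)‖ = 1 := by
    rw [Hilb.norm_eq, tsum_eq_single 0 (fun k hk => by rw [basisVec_apply, if_neg hk]; simp),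
      basisVec_apply]
    simp
  calc ‖trace x‖ ≤ ‖(basisVec 0 : Hilb d)‖ * ‖x (basisVec 0)‖ := norm_inner_le_norm _ _
    _ ≤ 1 * (‖x‖ * 1) := by
        rw [h]
        gcongr
        simpa [h] using x.le_opNorm (basisVec 0)
    _ = ‖x‖ := by ring

/-- `‖x‖_p = τ(|x|^p)^{1/p}` for `p < ∞`, with `|x| = (x^* x)^{1/2}`, and the operator norm for
`p = ∞`; for bounded operators `x`. -/
def pNorm {d : ℕ} (p : ℝ≥0∞) (x : Op d) : ℝ≥0∞ :=
  if p = ∞ then ‖x‖ₑ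
  else ENNReal.ofReal ((trace (CFC.abs x ^ p.toReal)).re ^ (1 / p.toReal))

/-! ### Smooth elements and distributions -/

/-- Rapidly decreasing families `(a_m)`. -/
def rapidDecay (d : ℕ) : Submodule ℂ ((Fin d → ℤ) → ℂ) where
  carrier := {a | ∀ N : ℕ, ∃ C : ℝ, ∀ n, (1 + ‖n‖) ^ N * ‖a n‖ ≤ C}
  zero_mem' := fun N => ⟨0, fun n => by simp⟩
  add_mem' := by
    intro a b ha hb N
    obtain ⟨A, hA⟩ := ha N
    obtain ⟨B, hB⟩ := hb N
    refine ⟨A + B, fun n => ?_⟩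
    calc (1 + ‖n‖) ^ N * ‖(a + b) n‖ ≤ (1 + ‖n‖) ^ N * (‖a n‖ + ‖b n‖) := by
          gcongr
          exact norm_add_le _ _
      _ ≤ A + B := by rw [mul_add]; exact add_le_add (hA n) (hB n)
  smul_mem' := by
    intro c a ha N
    obtain ⟨A, hA⟩ := ha N
    refine ⟨‖c‖ * A, fun n => ?_⟩
    calc (1 + ‖n‖) ^ N * ‖(c • a) n‖ = ‖c‖ * ((1 + ‖n‖) ^ N * ‖a n‖) := by
          rw [Pi.smul_apply, norm_smul]; ring
      _ ≤ ‖c‖ * A := by gcongr; exact hA n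

/-- The smooth algebra `𝒮(𝕋^d_θ)`: its element `∑ a_m U^m` is given by the rapidly decreasing
family `(a_m)`; the corresponding operator is `toOp`. -/
def Smooth {d : ℕ} (_θ : Matrix (Fin d) (Fin d) ℝ) : Type := rapidDecay d

instance {d : ℕ} (θ : Matrix (Fin d) (Fin d) ℝ) : AddCommGroup (Smooth θ) :=
  inferInstanceAs (AddCommGroup (rapidDecay d))

instance {d : ℕ} (θ : Matrix (Fin d) (Fin d) ℝ) : Module ℂ (Smooth θ) :=
  inferInstanceAs (Module ℂ (rapidDecay d))

/-- The coefficients `a_m` of `∑ a_m U^m`. -/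
def coeff {d : ℕ} {θ : Matrix (Fin d) (Fin d) ℝ} : Smooth θ →ₗ[ℂ] ((Fin d → ℤ) → ℂ) :=
  (rapidDecay d).subtype

theorem summable_weight (d : ℕ) :
    Summable fun n : Fin d → ℤ => ((1 + ‖n‖) ^ (2 * d))⁻¹ := by
  have hg : Summable fun z : ℤ => ((1 + ‖z‖) ^ 2)⁻¹ := by
    refine Summable.of_norm_bounded_eventually
      (Real.summable_one_div_int_pow (p := 2).2 (by norm_num)) ?_
    rw [Filter.eventually_cofinite]
    refine (Set.finite_singleton (0 : ℤ)).subset fun z hz => ?_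
    by_contra h0
    refine hz ?_
    have hz0 : (0 : ℝ) < |(z : ℝ)| := abs_pos.2 (Int.cast_ne_zero.2 h0)
    rw [norm_inv, norm_pow, Int.norm_eq_abs, one_div, ← sq_abs (z : ℝ), Real.norm_eq_abs,
      abs_of_pos (by linarith : (0 : ℝ) < 1 + |(z : ℝ)|)]
    gcongr
    linarith
  refine summable_of_sum_le (c := ∏ _j : Fin d, ∑' z : ℤ, ((1 + ‖z‖) ^ 2)⁻¹)
    (fun n => by positivity) fun u => ?_
  calc ∑ n ∈ u, ((1 + ‖n‖) ^ (2 * d))⁻¹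
      ≤ ∑ n ∈ u, ∏ j, ((1 + ‖n j‖) ^ 2)⁻¹ := by
        refine Finset.sum_le_sum fun n _ => ?_
        rw [Finset.prod_inv_distrib]
        refine inv_anti₀ (Finset.prod_pos fun j _ => by positivity) ?_
        calc ∏ j, (1 + ‖n j‖) ^ 2 ≤ ∏ _j : Fin d, (1 + ‖n‖) ^ 2 := by
              refine Finset.prod_le_prod (fun j _ => by positivity) fun j _ => ?_
              gcongr
              exact norm_le_pi_norm n j
          _ = (1 + ‖n‖) ^ (2 * d) := by simp [pow_mul]
    _ ≤ ∑ n ∈ Fintype.piFinset fun j => u.image fun n => n j, ∏ j, ((1 + ‖n j‖) ^ 2)⁻¹ := by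
        refine Finset.sum_le_sum_of_subset_of_nonneg (fun n hn => ?_)
          fun n _ _ => Finset.prod_nonneg fun j _ => by positivity
        exact Fintype.mem_piFinset.2 fun j => Finset.mem_image_of_mem _ hn
    _ = ∏ j, ∑ z ∈ u.image fun n => n j, ((1 + ‖z‖) ^ 2)⁻¹ :=
        (Finset.prod_univ_sum (fun j : Fin d => u.image fun n => n j)
          fun _ z => ((1 + ‖z‖) ^ 2)⁻¹).symm
    _ ≤ ∏ _j : Fin d, ∑' z : ℤ, ((1 + ‖z‖) ^ 2)⁻¹ := by
        refine Finset.prod_le_prod (fun j _ => Finset.sum_nonneg fun z _ => by positivity)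
          fun j _ => ?_
        exact hg.sum_le_tsum _ fun z _ => by positivity

theorem summable_norm_coeff {d : ℕ} {θ : Matrix (Fin d) (Fin d) ℝ} (a : Smooth θ) :
    Summable fun n => ‖coeff a n‖ := by
  obtain ⟨C, hC⟩ := a.2 (2 * d)
  refine Summable.of_nonneg_of_le (fun n => norm_nonneg _) (fun n => ?_)
    ((summable_weight d).mul_left C)
  have h := hC n
  have hpos : 0 < (1 + ‖n‖) ^ (2 * d) := by positivity
  rw [← div_eq_mul_inv, le_div_iff₀ hpos, mul_comm]
  exact h

theorem summable_coeff_smul {d : ℕ} {θ : Matrix (Fin d) (Fin d) ℝ} (a : Smooth θ) :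
    Summable fun n => coeff a n • mono θ n := by
  refine Summable.of_norm_bounded (summable_norm_coeff a) fun n => ?_
  rw [norm_smul]
  exact mul_le_of_le_one_right (norm_nonneg _) (norm_mono_le θ n)

/-- The operator `∑ a_m U^m` (a norm convergent series). -/
def toOp {d : ℕ} {θ : Matrix (Fin d) (Fin d) ℝ} : Smooth θ →ₗ[ℂ] Op d where
  toFun a := ∑' n, coeff a n • mono θ n
  map_add' a b := by
    rw [← (summable_coeff_smul a).tsum_add (summable_coeff_smul b)]
    simp [add_smul]
  map_smul' c a := by
    rw [RingHom.id_apply, ← (summable_coeff_smul a).tsum_const_smul]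
    simp [mul_smul]

/-- The partial derivation `D^m = ∂_1^{m_1} ⋯ ∂_d^{m_d}` on `𝒮(𝕋^d_θ)`, where
`∂_j (U^n) = 2πi n_j U^n`. -/
def derivS {d : ℕ} {θ : Matrix (Fin d) (Fin d) ℝ} (m : Fin d → ℕ) : Smooth θ →ₗ[ℂ] Smooth θ where
  toFun a := ⟨fun n => (∏ j, (2 * Real.pi * Complex.I * (n j : ℂ)) ^ m j) * coeff a n, by
    intro N
    obtain ⟨C, hC⟩ := a.2 (N + ∑ j, m j)
    refine ⟨(∏ j, (2 * Real.pi) ^ m j) * C, fun n => ?_⟩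
    have h1 : ‖∏ j, (2 * Real.pi * Complex.I * (n j : ℂ)) ^ m j‖ ≤
        (∏ j, (2 * Real.pi) ^ m j) * (1 + ‖n‖) ^ (∑ j, m j) := by
      rw [norm_prod, ← Finset.prod_pow_eq_pow_sum, ← Finset.prod_mul_distrib]
      refine Finset.prod_le_prod (fun j _ => norm_nonneg _) fun j _ => ?_
      rw [norm_pow, ← mul_pow]
      refine pow_le_pow_left₀ (norm_nonneg _) ?_ _
      have h2 : ‖n j‖ ≤ 1 + ‖n‖ := (norm_le_pi_norm n j).trans (by linarith)
      have h3 : ‖(2 * Real.pi * Complex.I * (n j : ℂ))‖ = 2 * Real.pi * ‖n j‖ := by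
        simp [abs_of_pos Real.pi_pos, Int.norm_eq_abs]
      rw [h3]
      have := Real.pi_pos
      gcongr
    calc (1 + ‖n‖) ^ N * ‖(∏ j, (2 * Real.pi * Complex.I * (n j : ℂ)) ^ m j) * coeff a n‖
        ≤ (1 + ‖n‖) ^ N * (((∏ j, (2 * Real.pi) ^ m j) * (1 + ‖n‖) ^ (∑ j, m j)) *
          ‖coeff a n‖) := by
          rw [norm_mul]
          gcongr
      _ = (∏ j, (2 * Real.pi) ^ m j) * ((1 + ‖n‖) ^ (N + ∑ j, m j) * ‖coeff a n‖) := by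
          rw [pow_add]; ring
      _ ≤ (∏ j, (2 * Real.pi) ^ m j) * C := by
          have := Real.pi_pos
          gcongr
          exact hC n⟩
  map_add' a b := by
    apply Subtype.ext
    funext n
    exact mul_add _ _ _
  map_smul' c a := by
    apply Subtype.ext
    funext n
    exact mul_left_comm _ _ _

theorem coeff_derivS {d : ℕ} {θ : Matrix (Fin d) (Fin d) ℝ} (m : Fin d → ℕ) (a : Smooth θ)
    (n : Fin d → ℤ) :
    coeff (derivS m a) n = (∏ j, (2 * Real.pi * Complex.I * (n j : ℂ)) ^ m j) * coeff a n := rfl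

theorem derivS_add {d : ℕ} {θ : Matrix (Fin d) (Fin d) ℝ} (m m' : Fin d → ℕ) :
    (derivS (m + m') : Smooth θ →ₗ[ℂ] Smooth θ) = derivS m ∘ₗ derivS m' := by
  refine LinearMap.ext fun a => Subtype.ext (funext fun n => ?_)
  change coeff (derivS (m + m') a) n = coeff (derivS m (derivS m' a)) n
  rw [coeff_derivS, coeff_derivS, coeff_derivS, ← mul_assoc, ← Finset.prod_mul_distrib]
  simp [pow_add]

/-- The multi-indices `m` with `|m|_1 ≤ k`. -/
def indicesLE (d k : ℕ) : Finset (Fin d → ℕ) :=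
  (Fintype.piFinset fun _ => Finset.range (k + 1)).filter fun m => ∑ j, m j ≤ k

theorem mem_indicesLE {d k : ℕ} (m : Fin d → ℕ) : m ∈ indicesLE d k ↔ ∑ j, m j ≤ k := by
  simp only [indicesLE, Finset.mem_filter, Fintype.mem_piFinset, Finset.mem_range]
  refine ⟨fun h => h.2, fun h => ⟨fun j => ?_, h⟩⟩
  exact Nat.lt_succ_of_le ((Finset.single_le_sum (fun i _ => Nat.zero_le _)
    (Finset.mem_univ j)).trans h)

/-- The multi-indices `m` with `|m|_1 = k`. -/
def indicesEq (d k : ℕ) : Finset (Fin d → ℕ) :=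
  (indicesLE d k).filter fun m => ∑ j, m j = k

theorem mem_indicesEq {d k : ℕ} (m : Fin d → ℕ) : m ∈ indicesEq d k ↔ ∑ j, m j = k := by
  simp only [indicesEq, Finset.mem_filter, mem_indicesLE, and_iff_right_iff_imp]
  exact le_of_eq

/-- The norms `p_k(x) = sup_{|m|_1 ≤ k} ‖D^m x‖_∞` on `𝒮(𝕋^d_θ)`. -/
def smoothSeminorm {d : ℕ} (θ : Matrix (Fin d) (Fin d) ℝ) : SeminormFamily ℂ (Smooth θ) ℕ :=
  fun k => (indicesLE d k).sup fun m => (normSeminorm ℂ (Op d)).comp (toOp ∘ₗ derivS m)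

/-- The topology of `𝒮(𝕋^d_θ)`. -/
instance {d : ℕ} (θ : Matrix (Fin d) (Fin d) ℝ) : TopologicalSpace (Smooth θ) :=
  (smoothSeminorm θ).moduleFilterBasis.topology

theorem withSeminorms {d : ℕ} (θ : Matrix (Fin d) (Fin d) ℝ) : WithSeminorms (smoothSeminorm θ) :=
  ⟨rfl⟩

instance {d : ℕ} (θ : Matrix (Fin d) (Fin d) ℝ) : IsTopologicalAddGroup (Smooth θ) :=
  (withSeminorms θ).topologicalAddGroup

theorem continuous_derivS {d : ℕ} {θ : Matrix (Fin d) (Fin d) ℝ} (m : Fin d → ℕ) :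
    Continuous (derivS m : Smooth θ →ₗ[ℂ] Smooth θ) := by
  refine WithSeminorms.continuous_of_isBounded (withSeminorms θ) (withSeminorms θ) _ fun k => ?_
  refine ⟨{k + ∑ j, m j}, 1, ?_⟩
  rw [Finset.sup_singleton, one_smul]
  intro a
  rw [Seminorm.comp_apply, smoothSeminorm]
  refine Seminorm.finset_sup_apply_le (apply_nonneg _ _) fun l hl => ?_
  have h : ((normSeminorm ℂ (Op d)).comp (toOp ∘ₗ derivS l)) (derivS m a) =
      ((normSeminorm ℂ (Op d)).comp (toOp ∘ₗ derivS (l + m))) a := by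
    rw [derivS_add]
    rfl
  rw [h]
  refine Seminorm.le_finset_sup_apply (p := fun m : Fin d → ℕ =>
    (normSeminorm ℂ (Op d)).comp (toOp ∘ₗ (derivS m : Smooth θ →ₗ[ℂ] Smooth θ))) ?_
  rw [mem_indicesLE] at hl ⊢
  simp only [Pi.add_apply, Finset.sum_add_distrib]
  omega

/-- Distributions: continuous linear functionals on `𝒮(𝕋^d_θ)`. -/
abbrev Distribution {d : ℕ} (θ : Matrix (Fin d) (Fin d) ℝ) : Type := Smooth θ →L[ℂ] ℂ

/-- The distribution `D^m F`, namely `a ↦ (-1)^{|m|_1} ⟨F, D^m a⟩`. -/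
def deriv {d : ℕ} {θ : Matrix (Fin d) (Fin d) ℝ} (m : Fin d → ℕ) (F : Distribution θ) :
    Distribution θ :=
  (-1 : ℂ) ^ (∑ j, m j) • F.comp ⟨derivS m, continuous_derivS m⟩

/-- The linear functional `a ↦ τ(y a)` on `𝒮(𝕋^d_θ)`. -/
def ofOpLin {d : ℕ} (θ : Matrix (Fin d) (Fin d) ℝ) (y : Op d) : Smooth θ →ₗ[ℂ] ℂ where
  toFun a := trace (y * toOp a)
  map_add' a b := by simp [trace, mul_add]
  map_smul' c a := by simp [trace]

/-- The distribution `a ↦ τ(y a)` induced by a bounded operator `y`. -/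
def ofOp {d : ℕ} (θ : Matrix (Fin d) (Fin d) ℝ) (y : Op d) : Distribution θ where
  toLinearMap := ofOpLin θ y
  cont := by
    refine WithSeminorms.continuous_normedSpace_rng ℂ (withSeminorms θ)
      (ofOpLin θ y) ⟨{0}, ‖y‖₊, fun a => ?_⟩
    rw [Finset.sup_singleton]
    change ‖trace (y * toOp a)‖ ≤ ‖y‖ * smoothSeminorm θ 0 a
    refine (norm_trace_le _).trans ((norm_mul_le _ _).trans ?_)
    refine mul_le_mul_of_nonneg_left ?_ (norm_nonneg _)
    have h0 : derivS 0 a = a := Subtype.ext (funext fun n => by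
      change coeff (derivS 0 a) n = coeff a n
      simp [coeff_derivS])
    have h := Seminorm.le_finset_sup_apply (s := indicesLE d 0) (x := a) (i := 0)
      (p := fun m : Fin d → ℕ =>
        (normSeminorm ℂ (Op d)).comp (toOp ∘ₗ (derivS m : Smooth θ →ₗ[ℂ] Smooth θ)))
      ((mem_indicesLE _).2 (by simp))
    have h2 : ((normSeminorm ℂ (Op d)).comp
        (toOp ∘ₗ (derivS 0 : Smooth θ →ₗ[ℂ] Smooth θ))) a = ‖toOp a‖ := by
      change ‖toOp (derivS 0 a)‖ = _
      rw [h0]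
    rw [← h2]
    exact h

/-- The smooth element `(U^n)^* = conj (c(n,-n)) U^{-n}`. -/
def monoStar {d : ℕ} (θ : Matrix (Fin d) (Fin d) ℝ) (n : Fin d → ℤ) : Smooth θ :=
  ⟨Pi.single (-n) ((starRingEnd ℂ) (cocycle θ n (-n))), by
    intro N
    refine ⟨(1 + ‖n‖) ^ N * ‖cocycle θ n (-n)‖, fun k => ?_⟩
    by_cases h : k = -n
    · subst h
      simp
    · simp only [Pi.single_eq_of_ne h, norm_zero, mul_zero]
      positivity⟩

theorem toOp_monoStar {d : ℕ} (θ : Matrix (Fin d) (Fin d) ℝ) (n : Fin d → ℤ) :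
    toOp (monoStar θ n) = star (mono θ n) := by
  rw [star_mono]
  change ∑' k, coeff (monoStar θ n) k • mono θ k = _
  rw [tsum_eq_single (-n)]
  · have h : coeff (monoStar θ n) (-n) = (starRingEnd ℂ) (cocycle θ n (-n)) :=
      Pi.single_eq_same (M := fun _ => ℂ) _ _
    rw [h]
  · intro k hk
    have h : coeff (monoStar θ n) k = 0 := Pi.single_eq_of_ne (M := fun _ => ℂ) hk _
    rw [h, zero_smul]

/-- The Fourier coefficient `F̂(n) = ⟨F, (U^n)^*⟩`. -/
def fourierCoeff {d : ℕ} {θ : Matrix (Fin d) (Fin d) ℝ} (F : Distribution θ) (n : Fin d → ℤ) : ℂ :=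
  F (monoStar θ n)

/-! ### `L_p` and Sobolev spaces -/

/-- `x_0, x_1, …` is a `‖·‖_p`-Cauchy sequence in `𝕋^d_θ`, and `F` is the distribution induced by
its limit in `L_p(𝕋^d_θ)`, i.e. `F(a) = lim τ(x_n a)` for all smooth `a`. -/
structure RepresentsLp {d : ℕ} {θ : Matrix (Fin d) (Fin d) ℝ} (p : ℝ≥0∞) (F : Distribution θ)
    (x : ℕ → torus θ) : Prop where
  cauchy : Tendsto (fun q : ℕ × ℕ => pNorm p ((x q.1 : Op d) - (x q.2 : Op d))) atTop (𝓝 0)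
  tendsto : ∀ a : Smooth θ, Tendsto (fun n => ofOp θ (x n : Op d) a) atTop (𝓝 (F a))

/-- `L_p(𝕋^d_θ)`, the completion of `(𝕋^d_θ, ‖·‖_p)`, as a set of distributions. (For `p = ∞` it is
`𝕋^d_θ` itself, which is complete in the operator norm.) -/
def Lp {d : ℕ} (θ : Matrix (Fin d) (Fin d) ℝ) (p : ℝ≥0∞) : Set (Distribution θ) :=
  {F | ∃ x, RepresentsLp p F x}

/-- The norm of `L_p(𝕋^d_θ)`: the limit of `‖x_n‖_p` for the Cauchy sequences `(x_n)` that
represent `F` (it does not depend on the sequence), and `∞` for `F` outside `L_p(𝕋^d_θ)`. -/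
def lpNorm {d : ℕ} {θ : Matrix (Fin d) (Fin d) ℝ} (p : ℝ≥0∞) (F : Distribution θ) : ℝ≥0∞ :=
  ⨅ (x : ℕ → torus θ) (_ : RepresentsLp p F x), limsup (fun n => pNorm p (x n : Op d)) atTop

/-- The `ℓ_p`-norm of a finite family: `(∑ c_m^p)^{1/p}`, or the maximum for `p = ∞`. -/
def finiteLp {ι : Type*} (p : ℝ≥0∞) (s : Finset ι) (c : ι → ℝ≥0∞) : ℝ≥0∞ :=
  if p = ∞ then s.sup c else (∑ m ∈ s, c m ^ p.toReal) ^ (1 / p.toReal)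

/-- The Sobolev space `W^k_p(𝕋^d_θ)`. -/
def Sobolev {d : ℕ} (θ : Matrix (Fin d) (Fin d) ℝ) (p : ℝ≥0∞) (k : ℕ) : Set (Distribution θ) :=
  {F | ∀ m : Fin d → ℕ, ∑ j, m j ≤ k → deriv m F ∈ Lp θ p}

/-- `‖F‖_{W^k_p} = (∑_{|m|_1 ≤ k} ‖D^m F‖_p^p)^{1/p}`. -/
def sobolevNorm {d : ℕ} {θ : Matrix (Fin d) (Fin d) ℝ} (p : ℝ≥0∞) (k : ℕ) (F : Distribution θ) :
    ℝ≥0∞ :=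
  finiteLp p (indicesLE d k) fun m => lpNorm p (deriv m F)

/-- `|F|_{W^k_p} = (∑_{|m|_1 = k} ‖D^m F‖_p^p)^{1/p}`. -/
def sobolevSeminorm {d : ℕ} {θ : Matrix (Fin d) (Fin d) ℝ} (p : ℝ≥0∞) (k : ℕ)
    (F : Distribution θ) : ℝ≥0∞ :=
  finiteLp p (indicesEq d k) fun m => lpNorm p (deriv m F)

/-- `V` is a linear subspace on which `N` is a (finite) norm. -/
structure IsNormOn {E : Type*} [AddCommGroup E] [Module ℂ E] (V : Set E) (N : E → ℝ≥0∞) :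
    Prop where
  zero_mem : (0 : E) ∈ V
  add_mem : ∀ x ∈ V, ∀ y ∈ V, x + y ∈ V
  smul_mem : ∀ (c : ℂ), ∀ x ∈ V, c • x ∈ V
  lt_top : ∀ x ∈ V, N x < ∞
  eq_zero_iff : ∀ x ∈ V, N x = 0 ↔ x = 0
  add_le : ∀ x ∈ V, ∀ y ∈ V, N (x + y) ≤ N x + N y
  smul_eq : ∀ (c : ℂ), ∀ x ∈ V, N (c • x) = ‖c‖ₑ * N x

end

end QuantumTorus

namespace QuantumTorus

noncomputable section

variable {d : ℕ} {θ : Matrix (Fin d) (Fin d) ℝ}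

/-! ### The quantum torus as a tracial von Neumann algebra -/

/-! On the Fourier side `∂_j` multiplies `U^n` by `2πi n_j`, and for `n ≠ 0` one may divide by this
factor at the first index `j` with `n_j ≠ 0`. Hence `F - F̂(0) = ∑_j M_j ∂_j F`, where `M_j` has the
symbol `1_{n_i = 0 for i < j} / (2πi n_j)` (`sub_mean_eq_sum`), and everything rests on `M_j` being
contractive for all `p` and `θ`. The factors `1_{n_i = 0}` and `1 / (2πi n_j)` are `∫_0^1 K(s)
e^{2πi s n} ds` for `K = 1` and for the sawtooth `K(s) = s - 1/2`. The corresponding multipliers are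
therefore averages `∫_0^1 K(s) V_s x V_s^* ds` along trace-preserving automorphisms, with `|K| ≤ 1`
(`isMultiplier_ite`, `isMultiplier_inv`). This gives (1) with `C = d`.

That such averages contract the `p`-norm needs this norm as a supremum of linear functionals, which
is what `DualBound` provides: `dualBound_rpow` and `rpow_le_of_dualBound` say that `‖x‖_p` is the
least dual bound of `x`. The first is Hölder's inequality, obtained from the three lines theorem and
the trace property; the second tests `x` against its own polar part. Dual bounds survive the
automorphisms and averaging, and being linear in `x` they also give the triangle inequality.

Multipliers act on `L_p` termwise on representing Cauchy sequences, and on distributions by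
transposition (`lpNorm_mulD_le`). For (2), every `D^m F` again has mean zero, so the first-order
estimate can be iterated at the cost of a factor `d` per order (`lpNorm_deriv_le`). For (3), the
mean is subtracted first. No constant depends on `p`, since a finite `ℓ_p`-norm lies between the
maximum and the sum. -/

theorem mem_centralizer_gen_iff (z : Op d) :
    z ∈ Set.centralizer (Set.range (fun j => (gen θ j : Op d)) ∪
      star (Set.range fun j => (gen θ j : Op d))) ↔ ∀ n, Commute z (mono θ n) := by
  constructor
  · intro hz n
    have h1 : ∀ j, Commute z (gen θ j : Op d) := fun j =>
      (hz _ (Or.inl ⟨j, rfl⟩)).symm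
    have h2 : ∀ j, Commute z (star (gen θ j : Op d)) := fun j =>
      (hz _ (Or.inr (by simp))).symm
    have h3 : ∀ j (a : ℤ), Commute z ((gen θ j ^ a : unitary (Op d)) : Op d) := by
      intro j a
      obtain ⟨m, rfl | rfl⟩ := a.eq_nat_or_neg
      · simpa using (h1 j).pow_right m
      · have : ((gen θ j ^ (-(m : ℤ)) : unitary (Op d)) : Op d) = star (gen θ j : Op d) ^ m := by
          rw [zpow_neg, zpow_natCast, ← inv_pow]
          rfl
        rw [this]
        exact (h2 j).pow_right m
    rw [mono_eq_prod, Submonoid.coe_list_prod]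
    refine Commute.list_prod_right _ _ fun y hy => ?_
    simp only [List.mem_map, List.mem_ofFn, exists_exists_eq_and] at hy
    obtain ⟨j, rfl⟩ := hy
    exact h3 _ _
  · rintro hz g (⟨j, rfl⟩ | ⟨j, hj⟩)
    · exact (hz (Pi.single j 1)).symm.eq
    · have hg : g = star (mono θ (Pi.single j 1)) := by
        rw [← star_star g, ← hj]
        rfl
      rw [hg, star_mono]
      exact ((hz _).smul_right _).symm.eq

/-- The quantum torus is the commutant of the commutant of the monomials. -/
theorem mem_torus_iff {x : Op d} :
    x ∈ torus θ ↔ ∀ z : Op d, (∀ n, Commute z (mono θ n)) → Commute z x := by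
  change x ∈ StarSubalgebra.centralizer ℂ _ ↔ _
  rw [StarSubalgebra.mem_centralizer_iff]
  constructor
  · intro h z hz
    exact (h z ((mem_centralizer_gen_iff z).2 hz)).1
  · intro h z hz
    refine ⟨h z ((mem_centralizer_gen_iff z).1 hz), h (star z) fun n => ?_⟩
    -- The adjoint of `U^{-n}` is a unimodular multiple of `U^n`; the scalar is then divided out.
    have := ((mem_centralizer_gen_iff z).1 hz (-n)).star_star
    rw [star_mono] at this
    have h2 := this.smul_right ((starRingEnd ℂ) (cocycle θ (-n) (- -n)))⁻¹
    rwa [smul_smul, inv_mul_cancel₀, one_smul, neg_neg] at h2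
    rw [Ne, map_eq_zero, ← norm_eq_zero, norm_cocycle]
    exact one_ne_zero

theorem mono_mem_torus (n : Fin d → ℤ) : mono θ n ∈ torus θ :=
  mem_torus_iff.2 fun _ hz => hz n

theorem smul_mem_torus {x : Op d} (c : ℂ) (hx : x ∈ torus θ) : c • x ∈ torus θ :=
  (torus θ).toStarSubalgebra.smul_mem hx c

theorem toOp_mem_torus (a : Smooth θ) : toOp a ∈ torus θ := by
  refine mem_torus_iff.2 fun z hz => ?_
  change z * (∑' n, coeff a n • mono θ n) = (∑' n, coeff a n • mono θ n) * z
  rw [← (summable_coeff_smul a).tsum_mul_left, ← (summable_coeff_smul a).tsum_mul_right]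
  exact tsum_congr fun n => ((hz n).smul_right _).eq

theorem rpow_mem_torus {x : Op d} (hx : x ∈ torus θ) (r : ℝ) : x ^ r ∈ torus θ :=
  mem_torus_iff.2 fun z hz => ((mem_torus_iff.1 hx z hz).symm.cfc_nnreal _).symm

theorem abs_mem_torus {x : Op d} (hx : x ∈ torus θ) : CFC.abs x ∈ torus θ :=
  mem_torus_iff.2 fun z hz => ((mem_torus_iff.1 hx z hz).symm.cfcAbs_left
    (star_star x ▸ (mem_torus_iff.1 (star_mem hx) z hz).star_star.symm)).symm

/-! ### Diagonal operators and right multiplications -/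

theorem memLp_diag (φ : (Fin d → ℤ) → ℂ) (hφ : ∀ n, ‖φ n‖ = 1) (f : Hilb d) :
    Memℓp (fun k : Fin d → ℤ => φ k * f k) 2 := by
  have h := (memℓp_gen_iff (p := 2) (by norm_num)).1 f.2
  refine (memℓp_gen_iff (p := 2) (by norm_num)).2 (h.congr fun k => ?_)
  rw [norm_mul, hφ, one_mul]

/-- The diagonal operator `e_n ↦ φ_n e_n` for unimodular `φ`. -/
def diag (φ : (Fin d → ℤ) → ℂ) (hφ : ∀ n, ‖φ n‖ = 1) : Op d :=
  LinearMap.mkContinuous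
    { toFun := fun f => (⟨fun k => φ k * f k, memLp_diag φ hφ f⟩ : Hilb d)
      map_add' := fun f g => Hilb.ext fun k => mul_add _ (f k) (g k)
      map_smul' := fun c f => Hilb.ext fun k => mul_left_comm _ c (f k) } 1 fun f => by
    rw [one_mul, Hilb.norm_eq, Hilb.norm_eq]
    refine le_of_eq (congrArg (· ^ (1 / (2 : ℝ))) (tsum_congr fun k => ?_))
    change ‖φ k * f k‖ ^ (2 : ℝ) = _
    rw [norm_mul, hφ, one_mul]

theorem conj_cocycle_mul_self (n k : Fin d → ℤ) :
    (starRingEnd ℂ) (cocycle θ n k) * cocycle θ n k = 1 := by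
  rw [← Complex.normSq_eq_conj_mul_self, Complex.normSq_eq_norm_sq, norm_cocycle]
  simp

/-- Right multiplication by `U^n` on the GNS space: `e_k ↦ c(k,n) e_{k+n}`. -/
def rightMono (θ : Matrix (Fin d) (Fin d) ℝ) (n : Fin d → ℤ) : Op d :=
  mono θ n * diag (fun k => cocycle θ k n * (starRingEnd ℂ) (cocycle θ n k)) fun k => by
    rw [norm_mul, RCLike.norm_conj, norm_cocycle, norm_cocycle, one_mul]

theorem rightMono_apply (n : Fin d → ℤ) (f : Hilb d) (k : Fin d → ℤ) :
    rightMono θ n f k = cocycle θ (k - n) n * f (k - n) := by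
  change cocycle θ n (k - n) * ((cocycle θ (k - n) n *
    (starRingEnd ℂ) (cocycle θ n (k - n))) * f (k - n)) = _
  linear_combination (cocycle θ (k - n) n * f (k - n)) * conj_cocycle_mul_self (θ := θ) n (k - n)

/-- This is associativity of the product, seen through the bimultiplicativity of the cocycle. It
places the right multiplications in the commutant of the torus. -/
theorem rightMono_commute_mono (n m : Fin d → ℤ) : Commute (rightMono θ n) (mono θ m) := by
  refine ContinuousLinearMap.ext fun f => Hilb.ext fun k => ?_
  change rightMono θ n (mono θ m f) k = mono θ m (rightMono θ n f) k
  rw [rightMono_apply, mono_apply, mono_apply, rightMono_apply]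
  have h1 : k - m - n = k - n - m := by abel
  have h2 : k - n = m + (k - n - m) := by abel
  have h3 : k - m = (k - n - m) + n := by abel
  rw [h1, h3, cocycle_add_right]
  conv_lhs => rw [h2, cocycle_add_left]
  rw [show m + (k - n - m) - m = k - n - m by abel]
  ring

theorem rightMono_basisVec_zero (n : Fin d → ℤ) : rightMono θ n (basisVec 0) = basisVec n := by
  refine Hilb.ext fun k => ?_
  rw [rightMono_apply, basisVec_apply, basisVec_apply]
  by_cases h : k = n
  · simp [h, cocycle_zero_left]
  · simp [h, sub_eq_zero]

/-- Since `x` commutes with right multiplications and these carry `e_0` to every `e_n`, the single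
vector `x e_0` determines `x`. -/
theorem apply_basisVec {x : Op d} (hx : x ∈ torus θ) (n : Fin d → ℤ) :
    x (basisVec n) = rightMono θ n (x (basisVec 0)) := by
  rw [← rightMono_basisVec_zero (θ := θ) n]
  exact (DFunLike.congr_fun (mem_torus_iff.1 hx _ (rightMono_commute_mono n)).eq (basisVec 0)).symm

theorem inner_basisVec_left (n : Fin d → ℤ) (f : Hilb d) : ⟪basisVec n, f⟫_ℂ = f n := by
  rw [Hilb.inner_eq, tsum_eq_single n]
  · rw [basisVec_apply, if_pos rfl, map_one, one_mul]
  · intro k hk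
    rw [basisVec_apply, if_neg hk, map_zero, zero_mul]

theorem norm_basisVec (n : Fin d → ℤ) : ‖(basisVec n : Hilb d)‖ = 1 := by
  have h : ⟪(basisVec n : Hilb d), basisVec n⟫_ℂ = 1 := by
    rw [inner_basisVec_left, basisVec_apply, if_pos rfl]
  refine (pow_eq_one_iff_of_nonneg (norm_nonneg _) two_ne_zero).1 ?_
  rw [← inner_self_eq_norm_sq (𝕜 := ℂ), h, RCLike.one_re]

/-- The Fourier coefficient of `x` at `n`: the scalar `α_n` of `x = ∑ α_m U^m`. -/
def fc (x : Op d) (n : Fin d → ℤ) : ℂ := x (basisVec 0) n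

/-- Both sides are `⟨e_0, x e_n⟩`, and `x e_n` is a right translate of `x e_0`. -/
theorem star_apply_basisVec_zero {x : Op d} (hx : x ∈ torus θ) (n : Fin d → ℤ) :
    (starRingEnd ℂ) (fc (star x) n) = cocycle θ (-n) n * fc x (-n) := by
  rw [fc, ← inner_basisVec_left, inner_conj_symm, ContinuousLinearMap.star_eq_adjoint,
    ContinuousLinearMap.adjoint_inner_left, apply_basisVec hx, inner_basisVec_left,
    rightMono_apply, zero_sub, fc]

theorem trace_mul_eq_inner (x y : Op d) :
    trace (x * y) = ⟪star x (basisVec 0), y (basisVec 0)⟫_ℂ := by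
  rw [trace, ContinuousLinearMap.star_eq_adjoint, ContinuousLinearMap.adjoint_inner_left]
  rfl

theorem trace_mul_eq_tsum {x : Op d} (hx : x ∈ torus θ) (y : Op d) :
    trace (x * y) = ∑' n, cocycle θ (-n) n * fc x (-n) * fc y n := by
  rw [trace_mul_eq_inner, Hilb.inner_eq]
  refine tsum_congr fun n => ?_
  rw [← star_apply_basisVec_zero hx]
  rfl

/-- The Fourier series of `τ(xy)` pairs `n` with `-n`; it is symmetric under `n ↦ -n` because
`c(n,-n) = c(-n,n)`. -/
theorem trace_mul_comm {x y : Op d} (hx : x ∈ torus θ) (hy : y ∈ torus θ) :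
    trace (x * y) = trace (y * x) := by
  rw [trace_mul_eq_tsum hx, trace_mul_eq_tsum hy, ← (Equiv.neg _).tsum_eq]
  refine tsum_congr fun n => ?_
  have h : cocycle θ n (-n) = cocycle θ (-n) n := by
    rw [← cocycle_neg_neg, neg_neg]
  simp only [Equiv.neg_apply, neg_neg, h]
  ring

theorem norm_apply_basisVec_sq (x : Op d) :
    (‖x (basisVec 0)‖ ^ 2 : ℝ) = (trace (star x * x)).re := by
  rw [trace_mul_eq_inner, star_star, inner_self_eq_norm_sq_to_K]
  norm_cast

theorem norm_star_apply_basisVec {x : Op d} (hx : x ∈ torus θ) :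
    ‖star x (basisVec 0)‖ = ‖x (basisVec 0)‖ := by
  rw [← sq_eq_sq₀ (norm_nonneg _) (norm_nonneg _), norm_apply_basisVec_sq,
    norm_apply_basisVec_sq, star_star, trace_mul_comm hx (star_mem hx)]

/-- The vector `e_0` is separating. -/
theorem eq_zero_of_fc_eq_zero {x : Op d} (hx : x ∈ torus θ) (h : ∀ n, fc x n = 0) : x = 0 := by
  have h0 : x (basisVec 0) = 0 := Hilb.ext h
  rw [← star_eq_zero]
  refine ContinuousLinearMap.ext fun f => Hilb.ext fun n => ?_
  rw [← inner_basisVec_left, ContinuousLinearMap.star_eq_adjoint,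
    ContinuousLinearMap.adjoint_inner_right, apply_basisVec hx, h0, map_zero, inner_zero_left]
  rfl

theorem torus_ext {x y : Op d} (hx : x ∈ torus θ) (hy : y ∈ torus θ)
    (h : ∀ n, fc x n = fc y n) : x = y := by
  refine sub_eq_zero.1 (eq_zero_of_fc_eq_zero (sub_mem hx hy) fun n => ?_)
  exact sub_eq_zero.2 (h n)

theorem fc_mono (n k : Fin d → ℤ) : fc (mono θ n) k = if k = n then 1 else 0 := by
  rw [fc, mono_basisVec, cocycle_zero_right, one_smul, add_zero, basisVec_apply]

theorem fc_toOp (a : Smooth θ) (n : Fin d → ℤ) : fc (toOp a) n = coeff a n := by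
  let L : Op d →L[ℂ] ℂ := (innerSL ℂ (basisVec n)) ∘L
    (ContinuousLinearMap.apply ℂ (Hilb d) (basisVec 0))
  have hL : ∀ x : Op d, L x = fc x n := fun x => inner_basisVec_left n (x (basisVec 0))
  rw [← hL]
  change L (∑' k, coeff a k • mono θ k) = _
  rw [L.map_tsum (summable_coeff_smul a), tsum_eq_single n]
  · rw [map_smul, hL, fc_mono, if_pos rfl, smul_eq_mul, mul_one]
  · intro k hk
    rw [map_smul, hL, fc_mono, if_neg hk.symm, smul_zero]

/-! ### Positivity of the trace -/

/-- The trace as a continuous linear functional. -/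
def traceL (d : ℕ) : Op d →L[ℂ] ℂ :=
  (innerSL ℂ (basisVec 0)) ∘L (ContinuousLinearMap.apply ℂ (Hilb d) (basisVec 0))

theorem traceL_apply (x : Op d) : traceL d x = trace x := rfl

theorem trace_add (x y : Op d) : trace (x + y) = trace x + trace y := (traceL d).map_add x y

theorem trace_smul (c : ℂ) (x : Op d) : trace (c • x) = c * trace x := (traceL d).map_smul c x

theorem trace_one : trace (1 : Op d) = 1 := by
  have h := trace_mono (0 : Matrix (Fin d) (Fin d) ℝ) 0
  rwa [mono_zero, if_pos rfl] at h

theorem trace_re_nonneg {h : Op d} (hh : 0 ≤ h) : 0 ≤ (trace h).re :=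
  ((ContinuousLinearMap.nonneg_iff_isPositive h).1 hh).re_inner_nonneg_right (basisVec 0)

theorem continuous_trace : Continuous (trace : Op d → ℂ) := (traceL d).continuous

/-- `|τ(hu)| ≤ ‖u‖ τ(h)` for positive `h`. -/
theorem norm_trace_mul_le {h u : Op d} (hh : 0 ≤ h) (hM : h ∈ torus θ) (hu : u ∈ torus θ) :
    ‖trace (h * u)‖ ≤ ‖u‖ * (trace h).re := by
  set s : Op d := h ^ (1 / 2 : ℝ) with hs
  have hsM : s ∈ torus θ := rpow_mem_torus hM _
  have hs0 : star s = s := (IsSelfAdjoint.of_nonneg CFC.rpow_nonneg).star_eq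
  have hss : s * s = h := by
    rw [hs, ← CFC.sqrt_eq_rpow, CFC.sqrt_mul_sqrt_self h hh]
  -- In `s u e_0` the factor `u` stands on the wrong side; traciality allows passing to the adjoint,
  -- `‖u^* s e_0‖`.
  have h1 : ‖(s * u) (basisVec 0)‖ ≤ ‖u‖ * ‖s (basisVec 0)‖ := by
    rw [← norm_star_apply_basisVec (mul_mem hsM hu), star_mul, hs0, ← norm_star u]
    exact (star u).le_opNorm _
  have h2 : ‖s (basisVec 0)‖ ^ 2 = (trace h).re := by
    rw [norm_apply_basisVec_sq, hs0, hss]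
  calc ‖trace (h * u)‖ = ‖⟪s (basisVec 0), (s * u) (basisVec 0)⟫_ℂ‖ := by
        rw [← hss, mul_assoc, trace_mul_eq_inner, hs0]
    _ ≤ ‖s (basisVec 0)‖ * ‖(s * u) (basisVec 0)‖ := norm_inner_le_norm _ _
    _ ≤ ‖s (basisVec 0)‖ * (‖u‖ * ‖s (basisVec 0)‖) := by gcongr
    _ = ‖u‖ * (trace h).re := by rw [← h2]; ring

/-! ### Complex powers and Hölder's inequality -/

/-- The complex power `c^z = exp (z log c)`. -/
def cpow (c : Op d) (z : ℂ) : Op d := NormedSpace.exp (z • CFC.log c)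

theorem cpow_add (c : Op d) (z w : ℂ) : cpow c (z + w) = cpow c z * cpow c w := by
  let +nondep : NormedAlgebra ℚ (Op d) := .restrictScalars ℚ ℂ (Op d)
  rw [cpow, add_smul, NormedSpace.exp_add_of_commute]
  · rfl
  · exact ((Commute.refl _).smul_left _).smul_right _

theorem cpow_mem_torus {c : Op d} (hc : c ∈ torus θ) (z : ℂ) : cpow c z ∈ torus θ :=
  mem_torus_iff.2 fun _ hz =>
    (((mem_torus_iff.1 hc _ hz).symm.cfc_real _).symm.smul_right z).exp_right

/-- Strict positivity keeps the spectrum away from `0`, where `log` is continuous, so the functional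
calculi compose. -/
theorem cpow_ofReal {c : Op d} (hc : IsStrictlyPositive c) (t : ℝ) : cpow c t = c ^ t := by
  have h0 : ∀ x ∈ spectrum ℝ c, 0 < x := fun x hx => hc.spectrum_pos hx
  have hlog : ContinuousOn Real.log (spectrum ℝ c) :=
    Real.continuousOn_log.mono fun x hx => (h0 x hx).ne'
  have hsa : IsSelfAdjoint c := hc.isSelfAdjoint
  have h1 : ((t : ℂ) • CFC.log c : Op d) = cfc (fun x => t * Real.log x) c := by
    rw [cfc_const_mul t Real.log c hlog, CFC.log]
    exact Complex.coe_smul _ _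
  rw [cpow, h1, ← CFC.real_exp_eq_normedSpace_exp (cfc_predicate _ c),
    ← cfc_comp' Real.exp (fun x => t * Real.log x) c (by fun_prop) (by fun_prop),
    CFC.rpow_eq_cfc_real hc.nonneg]
  refine cfc_congr fun x hx => ?_
  simp only [Real.rpow_def_of_pos (h0 x hx), mul_comm]

/-- The logarithm is self-adjoint, so an imaginary power satisfies `u^* u = 1`. -/
theorem norm_cpow_ofReal_mul_I_le (c : Op d) (t : ℝ) : ‖cpow c (t * Complex.I)‖ ≤ 1 := by
  have hL : IsSelfAdjoint (CFC.log c) := IsSelfAdjoint.log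
  have hs : star (cpow c (t * Complex.I)) = cpow c (-(t * Complex.I)) := by
    rw [cpow, NormedSpace.star_exp, star_smul, hL.star_eq, cpow]
    simp
  have h1 : star (cpow c (t * Complex.I)) * cpow c (t * Complex.I) = 1 := by
    rw [hs, ← cpow_add, neg_add_cancel, cpow, zero_smul, NormedSpace.exp_zero]
  have h2 := CStarRing.norm_star_mul_self (x := cpow c (t * Complex.I))
  rw [h1] at h2
  have h3 : ‖(1 : Op d)‖ ≤ 1 := ContinuousLinearMap.norm_id_le
  nlinarith [norm_nonneg (cpow c (t * Complex.I))]

theorem differentiable_cpow (c : Op d) : Differentiable ℂ (cpow c) := fun z =>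
  (hasDerivAt_exp_smul_const (𝕂 := ℂ) (CFC.log c) z).differentiableAt

/-- Splitting off the imaginary power reduces the bound to real exponents in a compact interval.
This is the boundedness on the strip required by the three lines theorem. -/
theorem exists_norm_cpow_le (c : Op d) (R : ℝ) :
    ∃ B, 0 ≤ B ∧ ∀ z : ℂ, 0 ≤ z.re → z.re ≤ R → ‖cpow c z‖ ≤ B := by
  obtain ⟨B, hB⟩ := (isCompact_Icc (a := (0 : ℝ)) (b := R)).exists_bound_of_continuousOn
    (f := fun t : ℝ => cpow c (t : ℂ))
    ((differentiable_cpow c).continuous.comp Complex.continuous_ofReal).continuousOn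
  refine ⟨max B 0, le_max_right _ _, fun z h0 h1 => ?_⟩
  have h : z = (z.re : ℂ) + (z.im : ℂ) * Complex.I := (Complex.re_add_im z).symm
  rw [h, cpow_add]
  refine (norm_mul_le _ _).trans ?_
  refine (mul_le_of_le_one_right (norm_nonneg _) (norm_cpow_ofReal_mul_I_le c _)).trans ?_
  exact (hB z.re ⟨h0, h1⟩).trans (le_max_left _ _)

/-- Hölder's inequality for positive elements separated by a contraction. -/
theorem norm_trace_rpow_mul_le {c a w : Op d} (hc : IsStrictlyPositive c)
    (ha : IsStrictlyPositive a) (hcM : c ∈ torus θ) (haM : a ∈ torus θ) (hwM : w ∈ torus θ)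
    (hw : ‖w‖ ≤ 1) {p : ℝ} (hp : 1 ≤ p) :
    ‖trace (c ^ (p - 1) * w * a)‖ ≤
      (trace (c ^ p)).re ^ (1 - 1 / p) * (trace (a ^ p)).re ^ (1 / p) := by
  have hp0 : 0 < p := by linarith
  have hpC : (p : ℂ) ≠ 0 := by exact_mod_cast hp0.ne'
  -- Interpolation function: at `z = 1/p` it is the trace to be bounded; on `Re z = 0` and `Re z =
  -- 1` it is `c^p`, respectively `a^p`, paired with a contraction.
  let F : ℂ → ℂ := fun z => trace (cpow c (p * (1 - z)) * w * cpow a (p * z))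
  have hF : ∀ z, F z = traceL d (cpow c (p * (1 - z)) * w * cpow a (p * z)) := fun _ => rfl
  have hdiff : Differentiable ℂ F := by
    have h1 : Differentiable ℂ fun z : ℂ => cpow c (p * (1 - z)) :=
      (differentiable_cpow c).comp (by fun_prop)
    have h2 : Differentiable ℂ fun z : ℂ => cpow a (p * z) :=
      (differentiable_cpow a).comp (by fun_prop)
    exact (traceL d).differentiable.comp ((h1.mul_const w).mul h2)
  have hbd : BddAbove ((norm ∘ F) '' Complex.HadamardThreeLines.verticalClosedStrip 0 1) := by
    obtain ⟨B, hB0, hB⟩ := exists_norm_cpow_le c p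
    obtain ⟨A, hA0, hA⟩ := exists_norm_cpow_le a p
    refine ⟨B * 1 * A, ?_⟩
    rintro _ ⟨z, hz, rfl⟩
    have hz' : 0 ≤ z.re ∧ z.re ≤ 1 := hz
    refine (norm_trace_le _).trans ((norm_mul_le _ _).trans ?_)
    refine mul_le_mul ((norm_mul_le _ _).trans ?_) (hA _ ?_ ?_) (norm_nonneg _) (by positivity)
    · refine mul_le_mul (hB _ ?_ ?_) hw (norm_nonneg _) hB0 <;>
        rw [Complex.re_ofReal_mul, Complex.sub_re, Complex.one_re] <;> nlinarith
    all_goals rw [Complex.re_ofReal_mul]; nlinarith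
  have hprod : ∀ s t : ℝ, ‖cpow c (s * Complex.I) * w * cpow a (t * Complex.I)‖ ≤ 1 := by
    intro s t
    have h1 := norm_cpow_ofReal_mul_I_le c s
    have h2 := norm_cpow_ofReal_mul_I_le a t
    refine (norm_mul_le _ _).trans (mul_le_one₀ ((norm_mul_le _ _).trans ?_) (norm_nonneg _) h2)
    exact mul_le_one₀ h1 (norm_nonneg _) hw
  have hprodM : ∀ s t : ℝ, cpow c (s * Complex.I) * w * cpow a (t * Complex.I) ∈ torus θ :=
    fun s t => mul_mem (mul_mem (cpow_mem_torus hcM _) hwM) (cpow_mem_torus haM _)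
  have key := Complex.HadamardThreeLines.norm_le_interp_of_mem_verticalClosedStrip' (f := F)
    (z := ((1 / p : ℝ) : ℂ)) (a := (trace (c ^ p)).re) (b := (trace (a ^ p)).re)
    (zero_lt_one' ℝ) ?_ hdiff.diffContOnCl hbd ?_ ?_
  · rw [Complex.ofReal_re, sub_zero, sub_zero, div_one] at key
    have hz : F ((1 / p : ℝ) : ℂ) = trace (c ^ (p - 1) * w * a) := by
      have h1 : (p : ℂ) * (1 - ((1 / p : ℝ) : ℂ)) = ((p - 1 : ℝ) : ℂ) := by
        push_cast
        field_simp
      have h2 : (p : ℂ) * ((1 / p : ℝ) : ℂ) = ((1 : ℝ) : ℂ) := by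
        push_cast
        field_simp
      change trace (cpow c (p * (1 - ((1 / p : ℝ) : ℂ))) * w * cpow a (p * ((1 / p : ℝ) : ℂ))) = _
      rw [h1, h2, cpow_ofReal hc, cpow_ofReal ha, CFC.rpow_one a ha.nonneg]
    rwa [hz] at key
  · change (0 : ℝ) ≤ _ ∧ _ ≤ (1 : ℝ)
    rw [Complex.ofReal_re]
    exact ⟨by positivity, by rw [div_le_one hp0]; exact hp⟩
  · intro z hz
    have hz0 : z = (z.im : ℂ) * Complex.I := by
      conv_lhs => rw [← Complex.re_add_im z]
      rw [show z.re = 0 from hz]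
      simp
    have h1 : (p : ℂ) * (1 - z) = (p : ℝ) + ((-(p * z.im) : ℝ) : ℂ) * Complex.I := by
      conv_lhs => rw [hz0]
      push_cast
      ring
    have h2 : (p : ℂ) * z = ((p * z.im : ℝ) : ℂ) * Complex.I := by
      conv_lhs => rw [hz0]
      push_cast
      ring
    change ‖trace (cpow c (p * (1 - z)) * w * cpow a (p * z))‖ ≤ _
    rw [h1, h2, cpow_add, cpow_ofReal hc, mul_assoc, mul_assoc, ← mul_assoc (cpow c _) w]
    refine (norm_trace_mul_le CFC.rpow_nonneg (rpow_mem_torus hcM _) (hprodM _ _)).trans ?_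
    exact mul_le_of_le_one_left (trace_re_nonneg CFC.rpow_nonneg) (hprod _ _)
  · intro z hz
    have hz0 : z = 1 + (z.im : ℂ) * Complex.I := by
      conv_lhs => rw [← Complex.re_add_im z]
      rw [show z.re = 1 from hz]
      simp
    have h1 : (p : ℂ) * (1 - z) = ((-(p * z.im) : ℝ) : ℂ) * Complex.I := by
      conv_lhs => rw [hz0]
      push_cast
      ring
    have h2 : (p : ℂ) * z = ((p * z.im : ℝ) : ℂ) * Complex.I + (p : ℝ) := by
      conv_lhs => rw [hz0]
      push_cast
      ring
    change ‖trace (cpow c (p * (1 - z)) * w * cpow a (p * z))‖ ≤ _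
    have h3 := norm_trace_mul_le CFC.rpow_nonneg (rpow_mem_torus haM p)
      (hprodM (-(p * z.im)) (p * z.im))
    -- On this side `a^p` is the last factor, so the trace property brings it into the position
    -- treated by `norm_trace_mul_le`.
    rw [trace_mul_comm (rpow_mem_torus haM p) (hprodM _ _)] at h3
    rw [h1, h2, cpow_add, cpow_ofReal ha, ← mul_assoc]
    exact h3.trans (mul_le_of_le_one_left (trace_re_nonneg CFC.rpow_nonneg) (hprod _ _))

/-! ### Duality for the noncommutative `L_p`-norms -/

/-- `|x| + ε`. -/
def absAdd (x : Op d) (ε : ℝ) : Op d := CFC.abs x + algebraMap ℝ (Op d) ε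

theorem algebraMap_mem_torus (ε : ℝ) : algebraMap ℝ (Op d) ε ∈ torus θ := by
  rw [Algebra.algebraMap_eq_smul_one, ← Complex.coe_smul]
  exact smul_mem_torus _ (one_mem _)

theorem absAdd_mem_torus {x : Op d} (hx : x ∈ torus θ) (ε : ℝ) : absAdd x ε ∈ torus θ :=
  add_mem (abs_mem_torus hx) (algebraMap_mem_torus ε)

theorem isStrictlyPositive_absAdd (x : Op d) {ε : ℝ} (hε : 0 < ε) :
    IsStrictlyPositive (absAdd x ε) := by
  have h : IsStrictlyPositive (algebraMap ℝ (Op d) ε) := isStrictlyPositive_algebraMap hε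
  exact h.nonneg_add (CFC.abs_nonneg x)

/-- For positive exponents the power map is norm continuous on the whole positive cone, including
its non-invertible elements. This removes the regularisation by `ε`. -/
theorem tendsto_trace_absAdd_rpow (x : Op d) {p : ℝ} (hp : 1 ≤ p) :
    Tendsto (fun ε => (trace (absAdd x ε ^ p)).re) (𝓝[>] 0) (𝓝 (trace (CFC.abs x ^ p)).re) := by
  refine (Complex.continuous_re.tendsto _).comp ((continuous_trace.tendsto _).comp ?_)
  have hp0 : 0 < p := by linarith
  have h1 : Tendsto (fun ε => absAdd x ε) (𝓝[>] 0) (𝓝[{a : Op d | 0 ≤ a}] (CFC.abs x)) := by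
    refine tendsto_nhdsWithin_iff.2 ⟨?_, ?_⟩
    · have : Continuous fun ε : ℝ => absAdd x ε :=
        continuous_const.add (continuous_algebraMap ℝ (Op d))
      have h2 := (this.tendsto 0).mono_left (nhdsWithin_le_nhds (s := Set.Ioi 0))
      simpa [absAdd] using h2
    · filter_upwards [self_mem_nhdsWithin] with ε hε
      exact (isStrictlyPositive_absAdd x hε).nonneg
  lift p to ℝ≥0 using hp0.le
  have h2 := (CFC.continuousOn_nnrpow (A := Op d) p (CFC.abs x)
    (CFC.abs_nonneg x)).tendsto.comp h1
  have h3 : ∀ a : Op d, a ^ p = a ^ (p : ℝ) := fun a =>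
    CFC.nnrpow_eq_rpow (by exact_mod_cast hp0)
  simpa only [Function.comp_def, h3] using h2

theorem absAdd_mul_rpow_neg_one (x : Op d) {ε : ℝ} (hε : 0 < ε) :
    absAdd x ε * absAdd x ε ^ (-1 : ℝ) = 1 := by
  have ha := isStrictlyPositive_absAdd x hε
  have := CFC.rpow_mul_rpow_neg (1 : ℝ) ha
  rwa [CFC.rpow_one _ ha.nonneg] at this

theorem rpow_neg_one_mul_absAdd (x : Op d) {ε : ℝ} (hε : 0 < ε) :
    absAdd x ε ^ (-1 : ℝ) * absAdd x ε = 1 := by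
  have ha := isStrictlyPositive_absAdd x hε
  have := CFC.rpow_neg_mul_rpow (1 : ℝ) ha
  rwa [CFC.rpow_one _ ha.nonneg] at this

theorem star_mul_self_eq (x : Op d) (ε : ℝ) :
    star x * x = absAdd x ε * absAdd x ε - (2 * ε) • absAdd x ε + ε ^ 2 • 1 := by
  rw [← CFC.abs_mul_abs, absAdd, Algebra.algebraMap_eq_smul_one]
  simp only [mul_add, add_mul, smul_add, mul_smul_comm, smul_mul_assoc, mul_one, one_mul,
    smul_smul]
  module

/-- With `a = |x| + ε` one has `x^* x = |x|² ≤ a²`; conjugate by `a^{-1}`. The contraction `x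
a^{-1}` replaces the partial isometry of the polar decomposition. -/
theorem norm_mul_absAdd_rpow_le (x : Op d) {ε : ℝ} (hε : 0 < ε) :
    ‖x * absAdd x ε ^ (-1 : ℝ)‖ ≤ 1 := by
  set a := absAdd x ε with ha
  set b := a ^ (-1 : ℝ) with hb
  have hbs : star b = b := (IsSelfAdjoint.of_nonneg CFC.rpow_nonneg).star_eq
  have h1 : star x * x ≤ a * a := by
    have h2 : a * a = star x * x + ((2 * ε) • CFC.abs x + ε ^ 2 • 1) := by
      rw [star_mul_self_eq x ε, ← ha, ha, absAdd, Algebra.algebraMap_eq_smul_one]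
      module
    rw [h2]
    refine le_add_of_nonneg_right (add_nonneg ?_ ?_)
    · exact smul_nonneg (by positivity) (CFC.abs_nonneg x)
    · exact smul_nonneg (by positivity) zero_le_one
  have h2 : star (x * b) * (x * b) ≤ 1 := by
    have h3 := star_left_conjugate_le_conjugate h1 b
    have h4 : star b * (a * a) * b = 1 := by
      rw [hbs, ← mul_assoc, rpow_neg_one_mul_absAdd x hε, one_mul, absAdd_mul_rpow_neg_one x hε]
    rw [h4] at h3
    refine le_trans (le_of_eq ?_) h3
    rw [star_mul]
    simp only [mul_assoc]
  have h3 := CStarAlgebra.norm_le_norm_of_nonneg_of_le (star_mul_self_nonneg (x * b)) h2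
  rw [CStarRing.norm_star_mul_self] at h3
  have h5 : ‖(1 : Op d)‖ ≤ 1 := ContinuousLinearMap.norm_id_le
  nlinarith [norm_nonneg (x * b)]

/-- `B` bounds the pairing of `x` with the elements `c^{p-1} w`, `c` positive, `w` a contraction;
these elements are of norm at most `τ(c^p)^{1-1/p}` in the dual space. -/
def DualBound (θ : Matrix (Fin d) (Fin d) ℝ) (p : ℝ) (x : Op d) (B : ℝ) : Prop :=
  ∀ c w : Op d, IsStrictlyPositive c → c ∈ torus θ → w ∈ torus θ → ‖w‖ ≤ 1 →
    ‖trace (c ^ (p - 1) * w * x)‖ ≤ B * (trace (c ^ p)).re ^ (1 - 1 / p)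

/-- Factor `x = (x a^{-1}) a` with `a = |x| + ε`, absorb the contraction `x a^{-1}` into `w`, apply
Hölder's inequality to `c` and `a`, and let `ε → 0`. -/
theorem dualBound_rpow {x : Op d} (hx : x ∈ torus θ) {p : ℝ} (hp : 1 ≤ p) :
    DualBound θ p x ((trace (CFC.abs x ^ p)).re ^ (1 / p)) := by
  intro c w hc hcM hwM hw
  have hlim : Tendsto (fun ε => (trace (absAdd x ε ^ p)).re ^ (1 / p) *
      (trace (c ^ p)).re ^ (1 - 1 / p)) (𝓝[>] 0)
      (𝓝 ((trace (CFC.abs x ^ p)).re ^ (1 / p) * (trace (c ^ p)).re ^ (1 - 1 / p))) :=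
    ((tendsto_trace_absAdd_rpow x hp).rpow_const (Or.inr (by positivity))).mul_const _
  refine ge_of_tendsto hlim ?_
  filter_upwards [self_mem_nhdsWithin] with ε hε
  have hε : 0 < ε := hε
  have h1 : ‖w * (x * absAdd x ε ^ (-1 : ℝ))‖ ≤ 1 :=
    (norm_mul_le _ _).trans (mul_le_one₀ hw (norm_nonneg _) (norm_mul_absAdd_rpow_le x hε))
  have haM := absAdd_mem_torus hx ε
  have h2 := norm_trace_rpow_mul_le hc (isStrictlyPositive_absAdd x hε) hcM haM
    (mul_mem hwM (mul_mem hx (rpow_mem_torus haM _))) h1 hp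
  have h3 : c ^ (p - 1) * (w * (x * absAdd x ε ^ (-1 : ℝ))) * absAdd x ε = c ^ (p - 1) * w * x := by
    simp only [mul_assoc, rpow_neg_one_mul_absAdd x hε, mul_one]
  rw [h3] at h2
  rwa [mul_comm]

/-- Test with `c = a = |x| + ε` and `w = (x a^{-1})^*`. The pairing is `τ(a^p)` up to terms in `ε`,
so in the limit `τ(|x|^p) ≤ B τ(|x|^p)^{1-1/p}`; divide, unless `τ(|x|^p) = 0`. -/
theorem rpow_le_of_dualBound {x : Op d} (hx : x ∈ torus θ) {p : ℝ} (hp : 1 ≤ p) {B : ℝ}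
    (hB : 0 ≤ B) (h : DualBound θ p x B) : (trace (CFC.abs x ^ p)).re ^ (1 / p) ≤ B := by
  have hp0 : 0 < p := by linarith
  have hq : 0 ≤ 1 - 1 / p := by rw [sub_nonneg, div_le_one hp0]; exact hp
  have hone : ‖(1 : Op d)‖ ≤ 1 := ContinuousLinearMap.norm_id_le
  have hT := tendsto_trace_absAdd_rpow x hp
  have hid : Tendsto (fun ε : ℝ => ε) (𝓝[>] 0) (𝓝 0) := tendsto_id.mono_left nhdsWithin_le_nhds
  have hlim1 := hT.sub ((hid.const_mul 2).mul (hT.rpow_const (p := 1 - 1 / p) (Or.inr hq)))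
  have hlim2 := (hT.rpow_const (p := 1 - 1 / p) (Or.inr hq)).const_mul B
  have key := le_of_tendsto_of_tendsto hlim1 hlim2 ?_
  · rw [mul_zero, zero_mul, sub_zero] at key
    rcases (trace_re_nonneg (CFC.rpow_nonneg (a := CFC.abs x) (y := p))).eq_or_lt with h0 | h0
    · rw [← h0, Real.zero_rpow (by positivity)]
      exact hB
    · have h1 : 0 < (trace (CFC.abs x ^ p)).re ^ (1 - 1 / p) := Real.rpow_pos_of_pos h0 _
      refine le_of_mul_le_mul_right ?_ h1
      rwa [← Real.rpow_add h0, add_sub_cancel, Real.rpow_one]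
  · filter_upwards [self_mem_nhdsWithin] with ε hε
    have hε : 0 < ε := hε
    have ha := isStrictlyPositive_absAdd x hε
    have haM := absAdd_mem_torus hx ε
    have hn := norm_mul_absAdd_rpow_le x hε
    have hab := absAdd_mul_rpow_neg_one x hε
    have hba := rpow_neg_one_mul_absAdd x hε
    have hsq := star_mul_self_eq x ε
    set a := absAdd x ε
    have hbs : star (a ^ (-1 : ℝ)) = a ^ (-1 : ℝ) :=
      (IsSelfAdjoint.of_nonneg CFC.rpow_nonneg).star_eq
    have hM : x * a ^ (-1 : ℝ) ∈ torus θ := mul_mem hx (rpow_mem_torus haM _)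
    have h1 := h a (star (x * a ^ (-1 : ℝ))) ha haM (star_mem hM) (by rwa [norm_star])
    have h2 : a ^ (p - 1) * star (x * a ^ (-1 : ℝ)) * x =
        a ^ p - (2 * ε) • a ^ (p - 1) + ε ^ 2 • a ^ (p - 1 + -1) := by
      have e1 : a ^ (p - 1) * a = a ^ p := by
        have := CFC.rpow_add (x := p - 1) (y := 1) ha.isUnit
        rwa [sub_add_cancel, CFC.rpow_one a ha.nonneg, eq_comm] at this
      rw [star_mul, hbs, mul_assoc, mul_assoc, hsq, CFC.rpow_add ha.isUnit]
      simp only [mul_add, mul_sub, mul_smul_comm, mul_one]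
      rw [← mul_assoc (a ^ (-1 : ℝ)), hba, one_mul, e1, mul_one]
    have h3 : (trace (a ^ (p - 1) * star (x * a ^ (-1 : ℝ)) * x)).re =
        (trace (a ^ p)).re - 2 * ε * (trace (a ^ (p - 1))).re +
          ε ^ 2 * (trace (a ^ (p - 1 + -1))).re := by
      rw [h2, ← Complex.coe_smul, ← Complex.coe_smul, ← traceL_apply, map_add, map_sub, map_smul,
        map_smul]
      simp only [traceL_apply, Complex.add_re, Complex.sub_re, smul_eq_mul, Complex.re_ofReal_mul]
    -- Hölder's inequality against the constant `1`, using `τ(1) = 1`.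
    have h4 : (trace (a ^ (p - 1))).re ≤ (trace (a ^ p)).re ^ (1 - 1 / p) := by
      have := norm_trace_rpow_mul_le (w := 1) ha isStrictlyPositive_one haM (one_mem _)
        (one_mem _) hone hp
      rw [mul_one, mul_one, CFC.one_rpow, trace_one, Complex.one_re, Real.one_rpow, mul_one] at this
      exact (Complex.re_le_norm _).trans this
    -- For `p < 2` the exponent here is negative and no bound uniform in `ε` is at hand; only the
    -- sign of this term is used.
    have h5 : 0 ≤ ε ^ 2 * (trace (a ^ (p - 1 + -1))).re :=
      mul_nonneg (by positivity) (trace_re_nonneg CFC.rpow_nonneg)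
    have h6 := (Complex.re_le_norm _).trans h1
    rw [h3] at h6
    have h7 : 2 * ε * (trace (a ^ (p - 1))).re ≤ 2 * ε * (trace (a ^ p)).re ^ (1 - 1 / p) := by
      gcongr
    linarith

/-! ### Properties of the `p`-norm -/

theorem pNorm_top (x : Op d) : pNorm ∞ x = ‖x‖ₑ := if_pos rfl

theorem pNorm_of_ne_top {p : ℝ≥0∞} (hp : p ≠ ∞) (x : Op d) :
    pNorm p x = ENNReal.ofReal ((trace (CFC.abs x ^ p.toReal)).re ^ (1 / p.toReal)) := if_neg hp

theorem pNorm_ne_top (p : ℝ≥0∞) (x : Op d) : pNorm p x ≠ ∞ := by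
  rw [pNorm]
  split_ifs
  · exact enorm_ne_top
  · exact ENNReal.ofReal_ne_top

theorem one_le_toReal {p : ℝ≥0∞} (h1 : 1 ≤ p) (hp : p ≠ ∞) : 1 ≤ p.toReal := by
  rw [← ENNReal.toReal_one]
  exact ENNReal.toReal_mono hp h1

theorem pNorm_le_of_dualBound {p : ℝ≥0∞} (h1 : 1 ≤ p) (hp : p ≠ ∞) {x : Op d} (hx : x ∈ torus θ)
    {B : ℝ} (hB : 0 ≤ B) (h : DualBound θ p.toReal x B) : pNorm p x ≤ ENNReal.ofReal B := by
  rw [pNorm_of_ne_top hp]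
  exact ENNReal.ofReal_le_ofReal (rpow_le_of_dualBound hx (one_le_toReal h1 hp) hB h)

theorem dualBound_pNorm {p : ℝ≥0∞} (h1 : 1 ≤ p) (hp : p ≠ ∞) {x : Op d} (hx : x ∈ torus θ) :
    DualBound θ p.toReal x (pNorm p x).toReal := by
  rw [pNorm_of_ne_top hp, ENNReal.toReal_ofReal]
  · exact dualBound_rpow hx (one_le_toReal h1 hp)
  · exact Real.rpow_nonneg (trace_re_nonneg CFC.rpow_nonneg) _

/-- If every dual bound for `x` is one for `y`, then `‖y‖_p ≤ ‖x‖_p`. -/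
theorem pNorm_le_pNorm {p : ℝ≥0∞} (h1 : 1 ≤ p) {x y : Op d} (hx : x ∈ torus θ) (hy : y ∈ torus θ)
    (htop : ‖y‖ ≤ ‖x‖) (h : ∀ r B, 0 ≤ B → DualBound θ r x B → DualBound θ r y B) :
    pNorm p y ≤ pNorm p x := by
  by_cases hp : p = ∞
  · subst hp
    rw [pNorm_top, pNorm_top]
    exact enorm_le_iff_norm_le.2 htop
  · rw [← ENNReal.ofReal_toReal (pNorm_ne_top p x)]
    exact pNorm_le_of_dualBound h1 hp hy ENNReal.toReal_nonneg
      (h _ _ ENNReal.toReal_nonneg (dualBound_pNorm h1 hp hx))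

theorem pNorm_add_le {p : ℝ≥0∞} (h1 : 1 ≤ p) {x y : Op d} (hx : x ∈ torus θ) (hy : y ∈ torus θ) :
    pNorm p (x + y) ≤ pNorm p x + pNorm p y := by
  by_cases hp : p = ∞
  · subst hp
    simp only [pNorm_top]
    exact enorm_add_le _ _
  · rw [← ENNReal.ofReal_toReal (pNorm_ne_top p x), ← ENNReal.ofReal_toReal (pNorm_ne_top p y),
      ← ENNReal.ofReal_add ENNReal.toReal_nonneg ENNReal.toReal_nonneg]
    refine pNorm_le_of_dualBound h1 hp (add_mem hx hy) (by positivity) fun c w hc hcM hwM hw => ?_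
    rw [mul_add, trace_add, add_mul]
    exact (norm_add_le _ _).trans (add_le_add (dualBound_pNorm h1 hp hx c w hc hcM hwM hw)
      (dualBound_pNorm h1 hp hy c w hc hcM hwM hw))

theorem pNorm_smul_le {p : ℝ≥0∞} (h1 : 1 ≤ p) {x : Op d} (hx : x ∈ torus θ) (c : ℂ) :
    pNorm p (c • x) ≤ ‖c‖ₑ * pNorm p x := by
  by_cases hp : p = ∞
  · subst hp
    simp only [pNorm_top]
    exact (enorm_smul c x).le
  · rw [← ENNReal.ofReal_toReal (pNorm_ne_top p x), ← ofReal_norm,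
      ← ENNReal.ofReal_mul (norm_nonneg _)]
    refine pNorm_le_of_dualBound h1 hp (smul_mem_torus c hx)
      (mul_nonneg (norm_nonneg _) ENNReal.toReal_nonneg) fun b w hb hbM hwM hw => ?_
    rw [mul_smul_comm, trace_smul, norm_mul, mul_assoc ‖c‖]
    exact mul_le_mul_of_nonneg_left (dualBound_pNorm h1 hp hx b w hb hbM hwM hw) (norm_nonneg _)

theorem pNorm_smul {p : ℝ≥0∞} (h1 : 1 ≤ p) {x : Op d} (hx : x ∈ torus θ) (c : ℂ) :
    pNorm p (c • x) = ‖c‖ₑ * pNorm p x := by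
  refine le_antisymm (pNorm_smul_le h1 hx c) ?_
  rcases eq_or_ne c 0 with rfl | hc
  · simp
  · calc ‖c‖ₑ * pNorm p x = ‖c‖ₑ * pNorm p (c⁻¹ • c • x) := by rw [inv_smul_smul₀ hc]
      _ ≤ ‖c‖ₑ * (‖c⁻¹‖ₑ * pNorm p (c • x)) := by
        gcongr
        exact pNorm_smul_le h1 (smul_mem_torus c hx) _
      _ = pNorm p (c • x) := by
        rw [← mul_assoc, ← enorm_mul, mul_inv_cancel₀ hc, enorm_one, one_mul]

theorem pNorm_one (p : ℝ≥0∞) : pNorm p (1 : Op d) = 1 := by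
  by_cases hp : p = ∞
  · subst hp
    have h : ‖(1 : Op d)‖ = 1 := by
      have h1 : ‖(1 : Op d)‖ ≤ 1 := ContinuousLinearMap.norm_id_le
      have h2 := norm_trace_le (1 : Op d)
      rw [trace_one, norm_one] at h2
      exact le_antisymm h1 h2
    rw [pNorm_top, ← ofReal_norm, h, ENNReal.ofReal_one]
  · rw [pNorm_of_ne_top hp, CFC.abs_one, CFC.one_rpow, trace_one, Complex.one_re, Real.one_rpow,
      ENNReal.ofReal_one]

/-- For `p < ∞` this is the dual bound at `c = 1`, `w = a / ‖a‖`. It makes the pairing with smooth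
elements continuous for `‖·‖_p`, hence the norm on distributions definite. -/
theorem enorm_trace_mul_le {p : ℝ≥0∞} (h1 : 1 ≤ p) {x a : Op d} (hx : x ∈ torus θ)
    (ha : a ∈ torus θ) : ‖trace (x * a)‖ₑ ≤ pNorm p x * ‖a‖ₑ := by
  by_cases hp : p = ∞
  · subst hp
    rw [pNorm_top, ← ofReal_norm, ← ofReal_norm, ← ofReal_norm,
      ← ENNReal.ofReal_mul (norm_nonneg _)]
    exact ENNReal.ofReal_le_ofReal ((norm_trace_le _).trans (norm_mul_le _ _))
  · rcases eq_or_ne a 0 with rfl | ha0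
    · rw [mul_zero, ← traceL_apply, map_zero]
      simp
    · have hn : ‖a‖ ≠ 0 := norm_ne_zero_iff.2 ha0
      have h2 := dualBound_pNorm h1 hp hx 1 ((‖a‖⁻¹ : ℂ) • a) isStrictlyPositive_one (one_mem _)
        (smul_mem_torus _ ha) (by
          rw [norm_smul, norm_inv, Complex.norm_real, norm_norm, inv_mul_cancel₀ hn])
      rw [CFC.one_rpow, CFC.one_rpow, trace_one, Complex.one_re, Real.one_rpow, mul_one, one_mul,
        smul_mul_assoc, trace_smul, norm_mul, norm_inv, Complex.norm_real, norm_norm,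
        trace_mul_comm ha hx, inv_mul_le_iff₀ (by positivity)] at h2
      rw [← ENNReal.ofReal_toReal (pNorm_ne_top p x), ← ofReal_norm, ← ofReal_norm,
        ← ENNReal.ofReal_mul ENNReal.toReal_nonneg, mul_comm]
      exact ENNReal.ofReal_le_ofReal h2

/-! ### The action of the torus -/

/-- The unitary `e_n ↦ e^{2πi s n_j} e_n`. -/
def rot (j : Fin d) (s : ℝ) : Op d :=
  diag (fun n => Complex.exp ((2 * Real.pi * s * n j : ℝ) * Complex.I)) fun _ =>
    Complex.norm_exp_ofReal_mul_I _

theorem rot_apply (j : Fin d) (s : ℝ) (f : Hilb d) (n : Fin d → ℤ) :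
    rot j s f n = Complex.exp ((2 * Real.pi * s * n j : ℝ) * Complex.I) * f n := rfl

theorem rot_zero (j : Fin d) : rot j 0 = 1 := by
  refine ContinuousLinearMap.ext fun f => Hilb.ext fun n => ?_
  rw [rot_apply]
  simp

theorem rot_mul (j : Fin d) (s t : ℝ) : rot j s * rot j t = rot j (s + t) := by
  refine ContinuousLinearMap.ext fun f => Hilb.ext fun n => ?_
  change rot j s (rot j t f) n = _
  rw [rot_apply, rot_apply, rot_apply, ← mul_assoc, ← Complex.exp_add]
  congr 2
  push_cast
  ring

theorem rot_mul_rot_neg (j : Fin d) (s : ℝ) : rot j s * rot j (-s) = 1 := by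
  rw [rot_mul, add_neg_cancel, rot_zero]

theorem rot_neg_mul_rot (j : Fin d) (s : ℝ) : rot j (-s) * rot j s = 1 := by
  rw [rot_mul, neg_add_cancel, rot_zero]

theorem norm_rot_apply (j : Fin d) (s : ℝ) (f : Hilb d) : ‖rot j s f‖ = ‖f‖ := by
  rw [Hilb.norm_eq, Hilb.norm_eq]
  congr 2
  funext k
  rw [rot_apply, norm_mul, Complex.norm_exp_ofReal_mul_I, one_mul]

theorem star_rot (j : Fin d) (s : ℝ) : star (rot j s) = rot j (-s) := by
  have h1 : star (rot j s) * rot j s = 1 := by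
    rw [ContinuousLinearMap.star_eq_adjoint]
    exact (ContinuousLinearMap.norm_map_iff_adjoint_comp_self _).1 (norm_rot_apply j s)
  exact left_inv_eq_right_inv h1 (rot_mul_rot_neg j s)

theorem rot_basisVec_zero (j : Fin d) (s : ℝ) : rot j s (basisVec 0) = basisVec 0 := by
  refine Hilb.ext fun n => ?_
  rw [rot_apply, basisVec_apply]
  split_ifs with h
  · simp [h]
  · rw [mul_zero]

/-- The automorphism `x ↦ V x V^*`, `V` being `rot j s`. -/
def rotAut (j : Fin d) (s : ℝ) (x : Op d) : Op d := rot j s * x * rot j (-s)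

theorem rotAut_mul (j : Fin d) (s : ℝ) (x y : Op d) :
    rotAut j s (x * y) = rotAut j s x * rotAut j s y := by
  simp only [rotAut, mul_assoc]
  rw [← mul_assoc (rot j (-s)) (rot j s), rot_neg_mul_rot, one_mul]

theorem rotAut_neg_rotAut (j : Fin d) (s : ℝ) (x : Op d) : rotAut j (-s) (rotAut j s x) = x := by
  simp only [rotAut, neg_neg]
  rw [mul_assoc, mul_assoc, mul_assoc, rot_neg_mul_rot, mul_one, ← mul_assoc, rot_neg_mul_rot,
    one_mul]

theorem rotAut_mono (j : Fin d) (s : ℝ) (n : Fin d → ℤ) :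
    rotAut j s (mono θ n) =
      Complex.exp ((2 * Real.pi * s * n j : ℝ) * Complex.I) • mono θ n := by
  refine ContinuousLinearMap.ext fun f => Hilb.ext fun k => ?_
  change rot j s (mono θ n (rot j (-s) f)) k =
    Complex.exp ((2 * Real.pi * s * n j : ℝ) * Complex.I) * mono θ n f k
  rw [rot_apply, mono_apply, rot_apply, mono_apply]
  have h : Complex.exp ((2 * Real.pi * s * k j : ℝ) * Complex.I) *
      Complex.exp ((2 * Real.pi * (-s) * (k - n) j : ℝ) * Complex.I) =
      Complex.exp ((2 * Real.pi * s * n j : ℝ) * Complex.I) := by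
    rw [← Complex.exp_add]
    congr 1
    rw [Pi.sub_apply]
    push_cast
    ring
  rw [← h]
  ring

/-- The automorphism scales each monomial, so it preserves the commutant of the monomials and
therefore also the bicommutant. -/
theorem rotAut_mem_torus (j : Fin d) (s : ℝ) {x : Op d} (hx : x ∈ torus θ) :
    rotAut j s x ∈ torus θ := by
  refine mem_torus_iff.2 fun z hz => ?_
  have h : Commute (rotAut j (-s) z) x := by
    refine mem_torus_iff.1 hx _ fun n => ?_
    have h1 : rotAut j (-s) (z * rotAut j s (mono θ n)) =
        rotAut j (-s) (rotAut j s (mono θ n) * z) := by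
      rw [rotAut_mono, ((hz n).smul_right _).eq]
    rwa [rotAut_mul, rotAut_mul, rotAut_neg_rotAut] at h1
  have h2 := congrArg (rotAut j s) h.eq
  have h3 := rotAut_neg_rotAut j (-s) z
  rw [neg_neg] at h3
  rwa [rotAut_mul, rotAut_mul, h3] at h2

theorem trace_rotAut (j : Fin d) (s : ℝ) (x : Op d) : trace (rotAut j s x) = trace x := by
  change ⟪basisVec 0, rot j s (x (rot j (-s) (basisVec 0)))⟫_ℂ = _
  rw [rot_basisVec_zero, ← ContinuousLinearMap.adjoint_inner_left,
    ← ContinuousLinearMap.star_eq_adjoint, star_rot, rot_basisVec_zero]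
  rfl

theorem norm_rotAut_le (j : Fin d) (s : ℝ) (x : Op d) : ‖rotAut j s x‖ ≤ ‖x‖ := by
  have h : ∀ t, ‖rot j t‖ ≤ 1 := fun t =>
    ContinuousLinearMap.opNorm_le_bound _ zero_le_one fun f => by rw [norm_rot_apply, one_mul]
  calc ‖rotAut j s x‖ ≤ ‖rot j s‖ * ‖x‖ * ‖rot j (-s)‖ :=
        (norm_mul_le _ _).trans (mul_le_mul_of_nonneg_right (norm_mul_le _ _) (norm_nonneg _))
    _ ≤ 1 * ‖x‖ * 1 := by
        gcongr
        exacts [h _, h _]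
    _ = ‖x‖ := by ring

/-- `rotAut` as a homomorphism of `*`-algebras. -/
def rotHom (j : Fin d) (s : ℝ) : Op d →⋆ₐ[ℂ] Op d where
  toFun := rotAut j s
  map_one' := by rw [rotAut, mul_one, rot_mul_rot_neg]
  map_mul' := rotAut_mul j s
  map_zero' := by rw [rotAut, mul_zero, zero_mul]
  map_add' x y := by simp only [rotAut, mul_add, add_mul]
  commutes' c := by
    rw [rotAut, Algebra.algebraMap_eq_smul_one, mul_smul_comm, smul_mul_assoc, mul_one,
      rot_mul_rot_neg]
  map_star' x := by
    rw [rotAut, rotAut, star_mul, star_mul, star_rot, star_rot, neg_neg, mul_assoc]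

theorem isStrictlyPositive_rotAut (j : Fin d) (s : ℝ) {c : Op d} (hc : IsStrictlyPositive c) :
    IsStrictlyPositive (rotAut j s c) := by
  refine ⟨?_, ?_⟩
  · rw [rotAut, ← star_rot]
    exact star_right_conjugate_nonneg hc.nonneg _
  · refine IsUnit.mul (IsUnit.mul ?_ hc.isUnit) ?_
    · exact ⟨⟨_, _, rot_mul_rot_neg j s, rot_neg_mul_rot j s⟩, rfl⟩
    · exact ⟨⟨_, _, rot_neg_mul_rot j s, rot_mul_rot_neg j s⟩, rfl⟩

theorem rotAut_rpow (j : Fin d) (s : ℝ) {c : Op d} (hc : IsStrictlyPositive c) (r : ℝ) :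
    rotAut j s (c ^ r) = rotAut j s c ^ r := by
  have hcont : Continuous (rotHom j s) := by
    change Continuous fun x => rot j s * x * rot j (-s)
    fun_prop
  have hc' := isStrictlyPositive_rotAut j s hc
  rw [CFC.rpow_eq_cfc_real hc.nonneg, CFC.rpow_eq_cfc_real hc'.nonneg]
  refine StarAlgHom.map_cfc (R := ℝ) (rotHom j s) _ _ ?_ hcont hc.isSelfAdjoint
    hc'.isSelfAdjoint
  exact fun x hx => (Real.continuousAt_rpow_const x r
    (Or.inl (hc.spectrum_pos hx).ne')).continuousWithinAt

/-- The trace is invariant, so the rotation can be moved from `x` to `c` and `w`; it commutes with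
powers of `c` and does not increase `‖w‖`. -/
theorem DualBound.rotAut {p B : ℝ} {x : Op d} (h : DualBound θ p x B) (j : Fin d) (s : ℝ) :
    DualBound θ p (rotAut j s x) B := by
  intro c w hc hcM hwM hw
  have h1 := h _ _ (isStrictlyPositive_rotAut j (-s) hc) (rotAut_mem_torus j (-s) hcM)
    (rotAut_mem_torus j (-s) hwM) ((norm_rotAut_le j (-s) w).trans hw)
  rw [← rotAut_rpow j (-s) hc, ← rotAut_rpow j (-s) hc, trace_rotAut] at h1
  rw [← trace_rotAut j (-s), rotAut_mul, rotAut_mul, rotAut_neg_rotAut]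
  exact h1

/-! ### Contractive Fourier multipliers -/

theorem continuous_inner_rot (j : Fin d) (f g : Hilb d) :
    Continuous fun s => ⟪f, rot j s g⟫_ℂ := by
  simp only [Hilb.inner_eq]
  have hs : Summable fun k => ‖f k‖ * ‖g k‖ := by
    have h := (lp.summable_inner (𝕜 := ℂ) (show lp (fun _ : Fin d → ℤ => ℂ) 2 from f)
      (show lp (fun _ : Fin d → ℤ => ℂ) 2 from g)).norm
    refine h.congr fun k => ?_
    rw [RCLike.inner_apply, norm_mul, RCLike.norm_conj, mul_comm]
  refine continuous_tsum (fun k => ?_) hs fun k s => ?_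
  · simp only [rot_apply]
    fun_prop
  · rw [rot_apply, norm_mul, norm_mul, RCLike.norm_conj, Complex.norm_exp_ofReal_mul_I, one_mul]

/-- Isometries that are weakly continuous in `s` are strongly continuous: `‖V_s f - V_t f‖² = 2‖f‖²
- 2 Re ⟨V_t f, V_s f⟩`. The averages below are accordingly integrals of vectors rather than of
operators. -/
theorem continuous_rot_apply (j : Fin d) (f : Hilb d) : Continuous fun s => rot j s f := by
  refine continuous_iff_continuousAt.2 fun t => ?_
  refine tendsto_iff_norm_sub_tendsto_zero.2 ?_
  have h1 : ∀ s, ‖rot j s f - rot j t f‖ =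
      √(2 * ‖f‖ ^ 2 - 2 * (⟪rot j t f, rot j s f⟫_ℂ).re) := by
    intro s
    have h := norm_sub_sq (𝕜 := ℂ) (rot j t f) (rot j s f)
    rw [norm_rot_apply, norm_rot_apply, RCLike.re_eq_complex_re] at h
    rw [norm_sub_rev, ← Real.sqrt_sq (norm_nonneg (rot j t f - rot j s f)), h]
    congr 1
    ring
  have h2 : Continuous fun s => √(2 * ‖f‖ ^ 2 - 2 * (⟪rot j t f, rot j s f⟫_ℂ).re) := by
    have := continuous_inner_rot j (rot j t f) f
    fun_prop
  simp only [h1]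
  have h3 := h2.tendsto t
  rwa [← h1, sub_self, norm_zero] at h3

theorem continuous_rotAut_apply (j : Fin d) (x : Op d) (f : Hilb d) :
    Continuous fun s => rotAut j s x f := by
  have h1 : Continuous fun q : Hilb d × ℝ => rot j q.2 q.1 := by
    refine continuous_prod_of_continuous_lipschitzWith _ 1 (fun g => continuous_rot_apply j g)
      fun s => ?_
    refine LipschitzWith.of_dist_le_mul fun g h => ?_
    rw [dist_eq_norm, dist_eq_norm, ← map_sub, norm_rot_apply, NNReal.coe_one, one_mul]
  have h2 : Continuous fun s => rot j (-s) f := (continuous_rot_apply j f).comp continuous_neg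
  exact h1.comp ((x.continuous.comp h2).prodMk continuous_id)

theorem continuous_smul_rotAut_apply {K : ℝ → ℝ} (hK : Continuous K) (j : Fin d) (x : Op d)
    (f : Hilb d) : Continuous fun s => (K s : ℂ) • rotAut j s x f :=
  (Complex.continuous_ofReal.comp hK).smul (continuous_rotAut_apply j x f)

theorem norm_integral_rotAut_le {K : ℝ → ℝ} (hK1 : ∀ s ∈ Set.Icc (0 : ℝ) 1, |K s| ≤ 1) (j : Fin d)
    (x : Op d) (f : Hilb d) :
    ‖∫ s in (0 : ℝ)..1, (K s : ℂ) • rotAut j s x f‖ ≤ ‖x‖ * ‖f‖ := by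
  have h := intervalIntegral.norm_integral_le_of_norm_le_const (a := (0 : ℝ)) (b := 1)
    (f := fun s => (K s : ℂ) • rotAut j s x f) (C := ‖x‖ * ‖f‖) fun s hs => ?_
  · simpa using h
  · rw [Set.uIoc_of_le zero_le_one] at hs
    rw [norm_smul, Complex.norm_real]
    calc |K s| * ‖rotAut j s x f‖ ≤ 1 * (‖x‖ * ‖f‖) := by
          refine mul_le_mul (hK1 s ⟨hs.1.le, hs.2⟩) ?_ (norm_nonneg _) zero_le_one
          exact ((rotAut j s x).le_opNorm f).trans
            (mul_le_mul_of_nonneg_right (norm_rotAut_le j s x) (norm_nonneg _))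
      _ = _ := one_mul _

/-- The weighted average `∫_0^1 K(s) V_s x V_s^* ds` of `x` along the action. -/
def rotAvg (K : ℝ → ℝ) (hK : Continuous K) (hK1 : ∀ s ∈ Set.Icc (0 : ℝ) 1, |K s| ≤ 1) (j : Fin d)
    (x : Op d) : Op d :=
  LinearMap.mkContinuous
    { toFun := fun f => ∫ s in (0 : ℝ)..1, (K s : ℂ) • rotAut j s x f
      map_add' := fun f g => by
        rw [← intervalIntegral.integral_add]
        · simp
        · exact (continuous_smul_rotAut_apply hK j x f).intervalIntegrable _ _
        · exact (continuous_smul_rotAut_apply hK j x g).intervalIntegrable _ _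
      map_smul' := fun c f => by
        rw [RingHom.id_apply, ← intervalIntegral.integral_smul]
        congr 1
        funext s
        rw [map_smul, smul_comm] } ‖x‖ (norm_integral_rotAut_le hK1 j x)

section

variable {K : ℝ → ℝ} {hK : Continuous K} {hK1 : ∀ s ∈ Set.Icc (0 : ℝ) 1, |K s| ≤ 1}

theorem rotAvg_apply (j : Fin d) (x : Op d) (f : Hilb d) :
    rotAvg K hK hK1 j x f = ∫ s in (0 : ℝ)..1, (K s : ℂ) • rotAut j s x f := rfl

theorem norm_rotAvg_le (j : Fin d) (x : Op d) : ‖rotAvg K hK hK1 j x‖ ≤ ‖x‖ :=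
  LinearMap.mkContinuous_norm_le _ (norm_nonneg _) _

theorem map_rotAvg_apply {E : Type*} [NormedAddCommGroup E] [NormedSpace ℂ E] [CompleteSpace E]
    (L : Hilb d →L[ℂ] E) (j : Fin d) (x : Op d) (f : Hilb d) :
    L (rotAvg K hK hK1 j x f) = ∫ s in (0 : ℝ)..1, (K s : ℂ) • L (rotAut j s x f) := by
  rw [rotAvg_apply, ← L.intervalIntegral_comp_comm
    ((continuous_smul_rotAut_apply hK j x f).intervalIntegrable _ _)]
  simp only [map_smul]

/-- Commutation with a bounded operator passes through the vector-valued integral. -/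
theorem rotAvg_mem_torus (j : Fin d) {x : Op d} (hx : x ∈ torus θ) :
    rotAvg K hK hK1 j x ∈ torus θ := by
  refine mem_torus_iff.2 fun z hz => ContinuousLinearMap.ext fun f => ?_
  change z (rotAvg K hK hK1 j x f) = rotAvg K hK hK1 j x (z f)
  rw [map_rotAvg_apply, rotAvg_apply]
  congr 1
  funext s
  congr 1
  exact DFunLike.congr_fun (mem_torus_iff.1 (rotAut_mem_torus j s hx) z hz).eq f

theorem trace_mul_rotAvg (j : Fin d) (y x : Op d) :
    trace (y * rotAvg K hK hK1 j x) =
      ∫ s in (0 : ℝ)..1, (K s : ℂ) • trace (y * rotAut j s x) :=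
  map_rotAvg_apply ((innerSL ℂ (basisVec 0)) ∘L y) j x (basisVec 0)

theorem dualBound_rotAvg {p B : ℝ} {x : Op d} (hB : 0 ≤ B) (h : DualBound θ p x B) (j : Fin d) :
    DualBound θ p (rotAvg K hK hK1 j x) B := by
  intro c w hc hcM hwM hw
  rw [trace_mul_rotAvg]
  have h0 : 0 ≤ B * (trace (c ^ p)).re ^ (1 - 1 / p) :=
    mul_nonneg hB (Real.rpow_nonneg (trace_re_nonneg CFC.rpow_nonneg) _)
  have h1 := intervalIntegral.norm_integral_le_of_norm_le_const (a := (0 : ℝ)) (b := 1)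
    (f := fun s => (K s : ℂ) • trace (c ^ (p - 1) * w * rotAut j s x))
    (C := B * (trace (c ^ p)).re ^ (1 - 1 / p)) fun s hs => ?_
  · simpa using h1
  · rw [Set.uIoc_of_le zero_le_one] at hs
    rw [norm_smul, Complex.norm_real, ← one_mul (B * _)]
    exact mul_le_mul (hK1 s ⟨hs.1.le, hs.2⟩) (h.rotAut j s c w hc hcM hwM hw) (norm_nonneg _)
      zero_le_one

theorem fc_rotAut (j : Fin d) (s : ℝ) (x : Op d) (n : Fin d → ℤ) :
    fc (rotAut j s x) n = Complex.exp ((2 * Real.pi * s * n j : ℝ) * Complex.I) * fc x n := by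
  change rot j s (x (rot j (-s) (basisVec 0))) n = _
  rw [rot_basisVec_zero, rot_apply, fc]

/-- Each rotation multiplies the `n`-th coefficient by a character, so averaging multiplies it by a
Fourier coefficient of `K`. -/
theorem fc_rotAvg (j : Fin d) (x : Op d) (n : Fin d → ℤ) :
    fc (rotAvg K hK hK1 j x) n =
      (∫ s in (0 : ℝ)..1, (K s : ℂ) * Complex.exp ((2 * Real.pi * s * n j : ℝ) * Complex.I)) *
        fc x n := by
  rw [fc, ← inner_basisVec_left]
  have h := map_rotAvg_apply (K := K) (hK := hK) (hK1 := hK1) (innerSL ℂ (basisVec n)) j x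
    (basisVec 0)
  refine h.trans ?_
  rw [← intervalIntegral.integral_mul_const]
  congr 1
  funext s
  rw [mul_assoc, ← fc_rotAut, smul_eq_mul, fc, ← inner_basisVec_left]
  rfl

end

/-- `k` is the symbol of a Fourier multiplier that is contractive for all `p`-norms. -/
def IsMultiplier (θ : Matrix (Fin d) (Fin d) ℝ) (k : (Fin d → ℤ) → ℂ) : Prop :=
  ∀ x ∈ torus θ, ∃ y ∈ torus θ, (∀ n, fc y n = k n * fc x n) ∧
    ∀ p : ℝ≥0∞, 1 ≤ p → pNorm p y ≤ pNorm p x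

theorem IsMultiplier.mul {k l : (Fin d → ℤ) → ℂ} (hk : IsMultiplier θ k) (hl : IsMultiplier θ l) :
    IsMultiplier θ (k * l) := by
  intro x hx
  obtain ⟨y, hy, hy1, hy2⟩ := hl x hx
  obtain ⟨z, hz, hz1, hz2⟩ := hk y hy
  refine ⟨z, hz, fun n => ?_, fun p hp => (hz2 p hp).trans (hy2 p hp)⟩
  rw [hz1, hy1, Pi.mul_apply, mul_assoc]

theorem isMultiplier_one : IsMultiplier θ 1 := fun x hx =>
  ⟨x, hx, fun n => by rw [Pi.one_apply, one_mul], fun _ _ => le_rfl⟩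

theorem IsMultiplier.prod {ι : Type*} (s : Finset ι) {k : ι → (Fin d → ℤ) → ℂ}
    (hk : ∀ i ∈ s, IsMultiplier θ (k i)) : IsMultiplier θ (∏ i ∈ s, k i) := by
  classical
  induction s using Finset.induction_on with
  | empty => exact isMultiplier_one
  | insert i s hi ih =>
    rw [Finset.prod_insert hi]
    exact (hk i (Finset.mem_insert_self _ _)).mul
      (ih fun i' hi' => hk i' (Finset.mem_insert_of_mem hi'))

theorem isMultiplier_integral {K : ℝ → ℝ} (hK : Continuous K)
    (hK1 : ∀ s ∈ Set.Icc (0 : ℝ) 1, |K s| ≤ 1) (j : Fin d) :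
    IsMultiplier θ fun n =>
      ∫ s in (0 : ℝ)..1, (K s : ℂ) * Complex.exp ((2 * Real.pi * s * n j : ℝ) * Complex.I) :=
  fun x hx => ⟨rotAvg K hK hK1 j x, rotAvg_mem_torus j hx, fc_rotAvg j x, fun _ hp =>
    pNorm_le_pNorm hp hx (rotAvg_mem_torus j hx) (norm_rotAvg_le j x)
      fun _ _ hB h => dualBound_rotAvg hB h j⟩

theorem exp_two_pi_int (m : ℤ) : Complex.exp (2 * Real.pi * Complex.I * m) = 1 := by
  rw [mul_comm]
  exact Complex.exp_int_mul_two_pi_mul_I m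

/-- Averaging with `K = 1` over a full period is the projection onto the frequencies with `n_j = 0`.
-/
theorem isMultiplier_ite (j : Fin d) : IsMultiplier θ fun n => if n j = 0 then 1 else 0 := by
  have h := isMultiplier_integral (θ := θ) (K := fun _ => 1) continuous_const
    (fun s _ => by simp) j
  convert h using 2 with n
  by_cases hn : n j = 0
  · simp [hn]
  · have hc : (2 * Real.pi * Complex.I * n j : ℂ) ≠ 0 := by
      simp [hn, Real.pi_ne_zero]
    rw [if_neg hn]
    have h1 : ∀ s : ℝ, ((1 : ℝ) : ℂ) * Complex.exp ((2 * Real.pi * s * n j : ℝ) * Complex.I) =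
        Complex.exp ((2 * Real.pi * Complex.I * n j) * s) := fun s => by
      rw [Complex.ofReal_one, one_mul]
      congr 1
      push_cast
      ring
    simp only [h1]
    rw [integral_exp_mul_complex hc]
    simp [exp_two_pi_int]

/-- The sawtooth `K(s) = s - 1/2` has these Fourier coefficients. At `n_j = 0` both sides vanish:
`K` has mean zero, and `0⁻¹ = 0`. -/
theorem isMultiplier_inv (j : Fin d) :
    IsMultiplier θ fun n => (2 * Real.pi * Complex.I * n j : ℂ)⁻¹ := by
  have h := isMultiplier_integral (θ := θ) (K := fun s => s - 1 / 2) (by fun_prop)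
    (fun s hs => by rw [abs_le]; constructor <;> linarith [hs.1, hs.2]) j
  convert h using 2 with n
  by_cases hn : n j = 0
  · simp only [hn, Int.cast_zero, mul_zero, inv_zero, Complex.ofReal_zero, zero_mul,
      Complex.exp_zero, mul_one]
    rw [intervalIntegral.integral_ofReal, intervalIntegral.integral_sub (by simp) (by simp),
      integral_id]
    norm_num
  · have hc : (2 * Real.pi * Complex.I * n j : ℂ) ≠ 0 := by
      simp [hn, Real.pi_ne_zero]
    set c : ℂ := 2 * Real.pi * Complex.I * n j with hcdef
    -- The antiderivative comes from integrating `(s - 1/2) e^{cs}` by parts.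
    have hd : ∀ s ∈ Set.uIcc (0 : ℝ) 1, HasDerivAt
        (fun s : ℝ => ((s : ℂ) - 1 / 2) * (Complex.exp (c * s) / c) - Complex.exp (c * s) / c ^ 2)
        (((s - 1 / 2 : ℝ) : ℂ) * Complex.exp ((2 * Real.pi * s * n j : ℝ) * Complex.I)) s := by
      intro s _
      have h1 : HasDerivAt (fun s : ℝ => (s : ℂ)) 1 s := Complex.ofRealCLM.hasDerivAt
      have h2 : HasDerivAt (fun s : ℝ => Complex.exp (c * s)) (Complex.exp (c * s) * (c * 1)) s :=
        (h1.const_mul c).cexp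
      have h3 := ((h1.sub_const (1 / 2)).mul (h2.div_const c)).sub (h2.div_const (c ^ 2))
      refine h3.congr_deriv ?_
      have h4 : ((2 * Real.pi * s * n j : ℝ) * Complex.I : ℂ) = c * s := by
        rw [hcdef]
        push_cast
        ring
      rw [h4]
      push_cast
      field_simp
      ring
    rw [intervalIntegral.integral_eq_sub_of_hasDerivAt hd
      (Continuous.intervalIntegrable (by fun_prop) _ _)]
    have h1 : Complex.exp c = 1 := exp_two_pi_int (n j)
    simp only [Complex.ofReal_one, Complex.ofReal_zero, mul_one, mul_zero, Complex.exp_zero, h1]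
    field_simp
    ring

theorem pNorm_zero {p : ℝ≥0∞} (h1 : 1 ≤ p) : pNorm p (0 : Op d) = 0 := by
  have h := pNorm_smul h1 (zero_mem (torus (0 : Matrix (Fin d) (Fin d) ℝ))) 0
  rwa [zero_smul, enorm_zero, zero_mul] at h

theorem IsMultiplier.neg {k : (Fin d → ℤ) → ℂ} (hk : IsMultiplier θ k) : IsMultiplier θ (-k) := by
  intro x hx
  obtain ⟨y, hy, hy1, hy2⟩ := hk x hx
  refine ⟨(-1 : ℂ) • y, smul_mem_torus _ hy, fun n => ?_, fun p hp => ?_⟩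
  · rw [Pi.neg_apply, neg_mul, ← hy1, ← neg_one_mul (fc y n)]
    rfl
  · rw [pNorm_smul hp hy, enorm_neg, enorm_one, one_mul]
    exact hy2 p hp

theorem fc_sub (x y : Op d) (n : Fin d → ℤ) : fc (x - y) n = fc x n - fc y n := rfl

/-- The images are determined by their Fourier coefficients, so the chosen map respects differences;
contractivity then carries Cauchy sequences to Cauchy sequences. -/
theorem IsMultiplier.exists_map {k : (Fin d → ℤ) → ℂ} (hk : IsMultiplier θ k) :
    ∃ T : torus θ → torus θ, (∀ x n, fc (T x : Op d) n = k n * fc (x : Op d) n) ∧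
      (∀ p : ℝ≥0∞, 1 ≤ p → ∀ x, pNorm p (T x : Op d) ≤ pNorm p (x : Op d)) ∧
      ∀ p : ℝ≥0∞, 1 ≤ p → ∀ x y,
        pNorm p ((T x : Op d) - (T y : Op d)) ≤ pNorm p ((x : Op d) - (y : Op d)) := by
  choose! T hT1 hT2 hT3 using hk
  refine ⟨fun x => ⟨T x, hT1 x x.2⟩, fun x => hT2 x x.2, fun p hp x => hT3 x x.2 p hp,
    fun p hp x y => ?_⟩
  have hxy : (x : Op d) - y ∈ torus θ := sub_mem x.2 y.2
  have h : T x - T y = T (x - y) := by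
    refine torus_ext (θ := θ) (sub_mem (hT1 x x.2) (hT1 y y.2)) (hT1 _ hxy) fun n => ?_
    rw [fc_sub, hT2 x x.2, hT2 y y.2, hT2 _ hxy, fc_sub, mul_sub]
  change pNorm p (T x - T y) ≤ _
  rw [h]
  exact hT3 _ hxy p hp

/-! ### Fourier multipliers on smooth elements and distributions -/

theorem smooth_ext {a b : Smooth θ} (h : ∀ n, coeff a n = coeff b n) : a = b :=
  Subtype.ext (funext h)

/-- Apply contractivity for `p = ∞` to the monomial `U^n`. -/
theorem IsMultiplier.norm_le {k : (Fin d → ℤ) → ℂ} (hk : IsMultiplier θ k) (n : Fin d → ℤ) :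
    ‖k n‖ ≤ 1 := by
  obtain ⟨y, -, hy1, hy2⟩ := hk _ (mono_mem_torus n)
  have h := hy2 ∞ le_top
  rw [pNorm_top, pNorm_top, enorm_le_iff_norm_le] at h
  have h1 := hy1 n
  rw [fc_mono, if_pos rfl, mul_one] at h1
  rw [← h1, fc, ← inner_basisVec_left]
  calc ‖⟪basisVec n, y (basisVec 0)⟫_ℂ‖ ≤ ‖(basisVec n : Hilb d)‖ * ‖y (basisVec 0)‖ :=
        norm_inner_le_norm _ _
    _ ≤ 1 * (‖y‖ * 1) := by
        rw [norm_basisVec]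
        gcongr
        simpa [norm_basisVec] using y.le_opNorm (basisVec 0)
    _ ≤ 1 := by
        rw [one_mul, mul_one]
        exact h.trans (norm_mono_le θ n)

/-- The Fourier multiplier with symbol `k` on smooth elements. -/
def mulS (k : (Fin d → ℤ) → ℂ) (hk : IsMultiplier θ k) : Smooth θ →ₗ[ℂ] Smooth θ where
  toFun a := ⟨fun n => k n * coeff a n, fun N => by
    obtain ⟨C, hC⟩ := a.2 N
    refine ⟨C, fun n => le_trans ?_ (hC n)⟩
    rw [norm_mul]
    gcongr
    exact mul_le_of_le_one_left (norm_nonneg _) (hk.norm_le n)⟩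
  map_add' a b := Subtype.ext (funext fun _ => mul_add _ _ _)
  map_smul' c a := Subtype.ext (funext fun _ => mul_left_comm _ _ _)

theorem coeff_mulS (k : (Fin d → ℤ) → ℂ) (hk : IsMultiplier θ k) (a : Smooth θ) (n : Fin d → ℤ) :
    coeff (mulS k hk a) n = k n * coeff a n := rfl

theorem norm_toOp_mulS_le (k : (Fin d → ℤ) → ℂ) (hk : IsMultiplier θ k) (a : Smooth θ) :
    ‖toOp (mulS k hk a)‖ ≤ ‖toOp a‖ := by
  obtain ⟨y, hy, hy1, hy2⟩ := hk _ (toOp_mem_torus a)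
  have h : toOp (mulS k hk a) = y := torus_ext (toOp_mem_torus _) hy fun n => by
    rw [fc_toOp, coeff_mulS, hy1, fc_toOp]
  have h2 := hy2 ∞ le_top
  rwa [pNorm_top, pNorm_top, enorm_le_iff_norm_le, ← h] at h2

theorem derivS_mulS (k : (Fin d → ℤ) → ℂ) (hk : IsMultiplier θ k) (m : Fin d → ℕ) (a : Smooth θ) :
    derivS m (mulS k hk a) = mulS k hk (derivS m a) := smooth_ext fun n => by
  rw [coeff_derivS, coeff_mulS, coeff_mulS, coeff_derivS, mul_left_comm]

/-- Multipliers commute with derivatives and contract the operator norm, so no defining seminorm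
increases. -/
theorem continuous_mulS (k : (Fin d → ℤ) → ℂ) (hk : IsMultiplier θ k) :
    Continuous (mulS k hk) := by
  refine WithSeminorms.continuous_of_isBounded (withSeminorms θ) (withSeminorms θ) _ fun r => ?_
  refine ⟨{r}, 1, ?_⟩
  rw [Finset.sup_singleton, one_smul]
  intro a
  rw [Seminorm.comp_apply, smoothSeminorm]
  refine Seminorm.finset_sup_apply_le (apply_nonneg _ _) fun l hl => ?_
  refine le_trans ?_ (Seminorm.le_finset_sup_apply (p := fun m : Fin d → ℕ =>
    (normSeminorm ℂ (Op d)).comp (toOp ∘ₗ (derivS m : Smooth θ →ₗ[ℂ] Smooth θ))) hl)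
  change ‖toOp (derivS l (mulS k hk a))‖ ≤ ‖toOp (derivS l a)‖
  rw [derivS_mulS]
  exact norm_toOp_mulS_le k hk _

/-- The Fourier multiplier with symbol `n ↦ k (-n)` on distributions. -/
def mulD (k : (Fin d → ℤ) → ℂ) (hk : IsMultiplier θ k) (F : Distribution θ) : Distribution θ :=
  F.comp ⟨mulS k hk, continuous_mulS k hk⟩

theorem mulD_apply (k : (Fin d → ℤ) → ℂ) (hk : IsMultiplier θ k) (F : Distribution θ)
    (a : Smooth θ) : mulD k hk F a = F (mulS k hk a) := rfl

/-! ### The norm of `L_p` on distributions -/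

theorem ennreal_limsup_add_le (u v : ℕ → ℝ≥0∞) :
    limsup (fun n => u n + v n) atTop ≤ limsup u atTop + limsup v atTop := by
  refine ENNReal.le_of_forall_pos_le_add fun ε hε hlt => ?_
  obtain ⟨hu, hv⟩ := ENNReal.add_lt_top.1 hlt
  have hε' : ((ε / 2 : ℝ≥0) : ℝ≥0∞) ≠ 0 := by
    rw [Ne, ENNReal.coe_eq_zero]
    exact (half_pos hε).ne'
  refine limsup_le_of_le (by isBoundedDefault) ?_
  filter_upwards [eventually_lt_of_limsup_lt (ENNReal.lt_add_right hu.ne hε'),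
    eventually_lt_of_limsup_lt (ENNReal.lt_add_right hv.ne hε')] with n h1 h2
  refine (add_le_add h1.le h2.le).trans (le_of_eq ?_)
  rw [add_add_add_comm, ← ENNReal.coe_add, add_halves]

theorem ofOp_apply (y : Op d) (a : Smooth θ) : ofOp θ y a = trace (y * toOp a) := rfl

theorem RepresentsLp.lpNorm_le {p : ℝ≥0∞} {F : Distribution θ} {x : ℕ → torus θ}
    (h : RepresentsLp p F x) : lpNorm p F ≤ limsup (fun n => pNorm p (x n : Op d)) atTop :=
  iInf₂_le x h

theorem RepresentsLp.add {p : ℝ≥0∞} (hp : 1 ≤ p) {F G : Distribution θ} {x y : ℕ → torus θ}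
    (hx : RepresentsLp p F x) (hy : RepresentsLp p G y) :
    RepresentsLp p (F + G) fun n => x n + y n where
  cauchy := by
    have h := hx.cauchy.add hy.cauchy
    rw [add_zero] at h
    refine tendsto_of_tendsto_of_tendsto_of_le_of_le tendsto_const_nhds h (fun _ => zero_le)
      fun q => ?_
    have h1 := pNorm_add_le hp (sub_mem (x q.1).2 (x q.2).2) (sub_mem (y q.1).2 (y q.2).2)
    refine le_trans (le_of_eq (congrArg _ ?_)) h1
    exact add_sub_add_comm _ _ _ _
  tendsto a := by
    refine ((hx.tendsto a).add (hy.tendsto a)).congr fun n => ?_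
    change _ = trace (((x n : Op d) + (y n : Op d)) * toOp a)
    rw [add_mul, trace_add]
    rfl

theorem RepresentsLp.smul {p : ℝ≥0∞} (hp : 1 ≤ p) {F : Distribution θ} {x : ℕ → torus θ}
    (hx : RepresentsLp p F x) (c : ℂ) :
    RepresentsLp p (c • F) fun n => ⟨c • (x n : Op d), smul_mem_torus c (x n).2⟩ where
  cauchy := by
    have h := ENNReal.Tendsto.const_mul hx.cauchy (Or.inr (enorm_ne_top (x := c)))
    rw [mul_zero] at h
    refine h.congr fun q => ?_
    rw [← pNorm_smul hp (sub_mem (x q.1).2 (x q.2).2), smul_sub]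
  tendsto a := by
    refine ((hx.tendsto a).const_mul c).congr fun n => ?_
    change _ = trace ((c • (x n : Op d)) * toOp a)
    rw [smul_mul_assoc, trace_smul]
    rfl

theorem representsLp_const {p : ℝ≥0∞} (hp : 1 ≤ p) (y : torus θ) :
    RepresentsLp p (ofOp θ (y : Op d)) fun _ => y where
  cauchy := by
    simp only [sub_self, pNorm_zero hp]
    exact tendsto_const_nhds
  tendsto _ := tendsto_const_nhds

theorem lpNorm_ofOp_le {p : ℝ≥0∞} (hp : 1 ≤ p) {y : Op d} (hy : y ∈ torus θ) :
    lpNorm p (ofOp θ y) ≤ pNorm p y := by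
  have h := (representsLp_const hp ⟨y, hy⟩).lpNorm_le
  rwa [limsup_const] at h

theorem lpNorm_add_le {p : ℝ≥0∞} (hp : 1 ≤ p) (F G : Distribution θ) :
    lpNorm p (F + G) ≤ lpNorm p F + lpNorm p G := by
  rw [lpNorm.eq_1 p F, lpNorm.eq_1 p G]
  simp only [ENNReal.iInf_add, ENNReal.add_iInf]
  refine le_iInf₂ fun x hx => le_iInf₂ fun y hy => ?_
  refine (hy.add hp hx).lpNorm_le.trans (le_trans (limsup_le_limsup ?_) (ennreal_limsup_add_le _ _))
  exact Eventually.of_forall fun n => pNorm_add_le hp (y n).2 (x n).2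

theorem ofOp_zero : ofOp θ (0 : Op d) = 0 := by
  ext a
  rw [ofOp_apply, zero_mul, ← traceL_apply, map_zero]
  rfl

theorem lpNorm_zero {p : ℝ≥0∞} (hp : 1 ≤ p) : lpNorm p (0 : Distribution θ) = 0 := by
  have h := lpNorm_ofOp_le (θ := θ) hp (zero_mem (torus θ))
  rw [ofOp_zero, pNorm_zero hp] at h
  exact le_antisymm h zero_le

theorem lpNorm_sum_le {p : ℝ≥0∞} (hp : 1 ≤ p) {ι : Type*} (s : Finset ι)
    (F : ι → Distribution θ) : lpNorm p (∑ i ∈ s, F i) ≤ ∑ i ∈ s, lpNorm p (F i) :=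
  Finset.le_sum_of_subadditive _ (lpNorm_zero hp).le (lpNorm_add_le hp) s F

/-- The restriction `c ≠ 0` lets the scalar pass into an infimum that is `∞` outside `L_p`. -/
theorem lpNorm_smul_le {p : ℝ≥0∞} (hp : 1 ≤ p) {c : ℂ} (hc : c ≠ 0) (F : Distribution θ) :
    lpNorm p (c • F) ≤ ‖c‖ₑ * lpNorm p F := by
  have hc0 : ‖c‖ₑ ≠ 0 := enorm_ne_zero.2 hc
  rw [lpNorm.eq_1 p F]
  simp only [ENNReal.mul_iInf_of_ne hc0 enorm_ne_top]
  refine le_iInf₂ fun x hx => ?_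
  refine (hx.smul hp c).lpNorm_le.trans (le_of_eq ?_)
  rw [← ENNReal.limsup_const_mul_of_ne_top enorm_ne_top]
  exact limsup_congr (Eventually.of_forall fun n => pNorm_smul hp (x n).2 c)

theorem lpNorm_smul {p : ℝ≥0∞} (hp : 1 ≤ p) (c : ℂ) (F : Distribution θ) :
    lpNorm p (c • F) = ‖c‖ₑ * lpNorm p F := by
  rcases eq_or_ne c 0 with rfl | hc
  · rw [zero_smul ℂ F, lpNorm_zero hp, enorm_zero, zero_mul]
  · refine le_antisymm (lpNorm_smul_le hp hc F) ?_
    calc ‖c‖ₑ * lpNorm p F = ‖c‖ₑ * lpNorm p (c⁻¹ • c • F) := by rw [inv_smul_smul₀ hc]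
      _ ≤ ‖c‖ₑ * (‖c⁻¹‖ₑ * lpNorm p (c • F)) := by
        gcongr
        exact lpNorm_smul_le hp (inv_ne_zero hc) _
      _ = lpNorm p (c • F) := by
        rw [← mul_assoc, ← enorm_mul, mul_inv_cancel₀ hc, enorm_one, one_mul]

/-- Pass to the limit in `enorm_trace_mul_le` along each representing sequence. When `toOp a = 0`
the right side could read `∞ * 0 = 0`, but then `a = 0`. -/
theorem enorm_apply_le {p : ℝ≥0∞} (hp : 1 ≤ p) (F : Distribution θ) (a : Smooth θ) :
    ‖F a‖ₑ ≤ lpNorm p F * ‖toOp a‖ₑ := by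
  rcases eq_or_ne (toOp a) 0 with h0 | h0
  · have ha : a = 0 := smooth_ext fun n => by
      rw [← fc_toOp, h0, map_zero]
      rfl
    rw [ha, map_zero, enorm_zero]
    exact zero_le
  · rw [lpNorm, mul_comm]
    simp only [ENNReal.mul_iInf_of_ne (enorm_ne_zero.2 h0) enorm_ne_top]
    refine le_iInf₂ fun x hx => ?_
    rw [← ENNReal.limsup_const_mul_of_ne_top enorm_ne_top, ← (hx.tendsto a).enorm.limsup_eq]
    refine limsup_le_limsup (Eventually.of_forall fun n => ?_)
    change _ ≤ ‖toOp a‖ₑ * pNorm p (x n : Op d)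
    rw [mul_comm]
    exact enorm_trace_mul_le hp (x n).2 (toOp_mem_torus a)

theorem eq_zero_of_lpNorm_eq_zero {p : ℝ≥0∞} (hp : 1 ≤ p) {F : Distribution θ}
    (h : lpNorm p F = 0) : F = 0 := by
  ext a
  have h1 := enorm_apply_le hp F a
  rw [h, zero_mul, nonpos_iff_eq_zero, enorm_eq_zero] at h1
  exact h1

theorem lpNorm_lt_top {p : ℝ≥0∞} (hp : 1 ≤ p) {F : Distribution θ} (hF : F ∈ Lp θ p) :
    lpNorm p F < ∞ := by
  obtain ⟨x, hx⟩ := hF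
  obtain ⟨q, hq⟩ := eventually_atTop.1 (hx.cauchy.eventually (gt_mem_nhds one_pos))
  refine hx.lpNorm_le.trans_lt (lt_of_le_of_lt (b := 1 + pNorm p (x q.2 : Op d)) ?_ ?_)
  · refine limsup_le_of_le (by isBoundedDefault) ?_
    filter_upwards [eventually_ge_atTop q.1] with n hn
    have h1 := pNorm_add_le hp (sub_mem (x n).2 (x q.2).2) (x q.2).2
    rw [sub_add_cancel] at h1
    have h2 := (hq (n, q.2) ⟨hn, le_rfl⟩).le
    exact h1.trans (add_le_add h2 le_rfl)
  · exact ENNReal.add_lt_top.2 ⟨ENNReal.one_lt_top, (pNorm_ne_top _ _).lt_top⟩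

/-- The trace pairs frequency `-n` of one factor with `n` of the other, so the transpose of a
multiplier has the reflected symbol. -/
theorem trace_mul_toOp_mulS {k : (Fin d → ℤ) → ℂ} (hk : IsMultiplier θ k) {x y : Op d}
    (hx : x ∈ torus θ) (hy : y ∈ torus θ) (h : ∀ n, fc y n = k (-n) * fc x n) (a : Smooth θ) :
    trace (y * toOp a) = trace (x * toOp (mulS k hk a)) := by
  rw [trace_mul_eq_tsum hx, trace_mul_eq_tsum hy]
  refine tsum_congr fun n => ?_
  rw [fc_toOp, fc_toOp, coeff_mulS, h, neg_neg]
  ring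

theorem lpNorm_mulD_le {p : ℝ≥0∞} (hp : 1 ≤ p) {k : (Fin d → ℤ) → ℂ} (hk : IsMultiplier θ k)
    (hk' : IsMultiplier θ fun n => k (-n)) (F : Distribution θ) :
    lpNorm p (mulD k hk F) ≤ lpNorm p F := by
  obtain ⟨T, hT1, hT2, hT3⟩ := hk'.exists_map
  rw [lpNorm.eq_1 p F]
  refine le_iInf₂ fun x hx => ?_
  have h : RepresentsLp p (mulD k hk F) fun n => T (x n) :=
    { cauchy := tendsto_of_tendsto_of_tendsto_of_le_of_le tendsto_const_nhds hx.cauchy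
        (fun _ => zero_le) fun q => hT3 p hp _ _
      tendsto := fun a => by
        refine (hx.tendsto (mulS k hk a)).congr fun n => ?_
        exact (trace_mul_toOp_mulS hk (x n).2 (T (x n)).2 (hT1 _) a).symm }
  exact h.lpNorm_le.trans (limsup_le_limsup (Eventually.of_forall fun n => hT2 p hp _))

/-! ### The Poincaré inequality for the derivatives of first order -/

/-- The symbol `-1_{n_i = 0 for i < j} / (2πi n_j)`. -/
def poincareSymbol (j : Fin d) : (Fin d → ℤ) → ℂ :=
  -((∏ i ∈ Finset.univ.filter (· < j), fun n : Fin d → ℤ => if n i = 0 then (1 : ℂ) else 0) *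
    fun n => (2 * Real.pi * Complex.I * n j : ℂ)⁻¹)

theorem isMultiplier_poincareSymbol (j : Fin d) : IsMultiplier θ (poincareSymbol j) :=
  ((IsMultiplier.prod _ fun i _ => isMultiplier_ite i).mul (isMultiplier_inv j)).neg

theorem poincareSymbol_neg (j : Fin d) :
    (fun n => poincareSymbol j (-n)) = -poincareSymbol j := by
  funext n
  simp [poincareSymbol, inv_neg]

theorem isMultiplier_poincareSymbol_neg (j : Fin d) :
    IsMultiplier θ fun n => poincareSymbol j (-n) := by
  rw [poincareSymbol_neg]
  exact (isMultiplier_poincareSymbol j).neg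

/-- Only the first `j` with `n_j ≠ 0` contributes: earlier terms have the factor `n_j = 0`, later
ones a vanishing indicator. -/
theorem sum_mul_poincareSymbol (n : Fin d → ℤ) :
    ∑ j, (2 * Real.pi * Complex.I * n j : ℂ) * poincareSymbol j n = if n = 0 then 0 else -1 := by
  split_ifs with h
  · simp [h]
  · obtain ⟨j, hj, hmin⟩ : ∃ j, n j ≠ 0 ∧ ∀ i < j, n i = 0 := by
      have hne : (Finset.univ.filter fun j => n j ≠ 0).Nonempty := by
        obtain ⟨j, hj⟩ := Function.ne_iff.1 h
        exact ⟨j, by simpa using hj⟩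
      refine ⟨_, (Finset.mem_filter.1 (Finset.min'_mem _ hne)).2, fun i hi => ?_⟩
      by_contra h0
      exact absurd (Finset.min'_le _ i (by simpa using h0)) (not_le.2 hi)
    rw [Finset.sum_eq_single j]
    · have hc : (2 * Real.pi * Complex.I * n j : ℂ) ≠ 0 := by simp [hj, Real.pi_ne_zero]
      have hp : (∏ i ∈ Finset.univ.filter (· < j), if n i = 0 then (1 : ℂ) else 0) = 1 :=
        Finset.prod_eq_one fun i hi => if_pos (hmin i (Finset.mem_filter.1 hi).2)
      rw [poincareSymbol, Pi.neg_apply, Pi.mul_apply, Finset.prod_apply, hp, one_mul, mul_neg,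
        mul_inv_cancel₀ hc]
    · intro l _ hl
      rcases lt_or_gt_of_ne hl with hlt | hlt
      · simp [hmin l hlt]
      · have hp : (∏ i ∈ Finset.univ.filter (· < l), if n i = 0 then (1 : ℂ) else 0) = 0 :=
          Finset.prod_eq_zero (i := j) (by simpa using hlt) (if_neg hj)
        rw [poincareSymbol, Pi.neg_apply, Pi.mul_apply, Finset.prod_apply, hp]
        simp
    · simp

theorem deriv_apply (m : Fin d → ℕ) (F : Distribution θ) (a : Smooth θ) :
    deriv m F a = (-1 : ℂ) ^ (∑ j, m j) * F (derivS m a) := rfl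

theorem coeff_monoStar_zero (n : Fin d → ℤ) :
    coeff (monoStar θ 0) n = if n = 0 then 1 else 0 := by
  change (Pi.single (-0) ((starRingEnd ℂ) (cocycle θ 0 (-0))) : (Fin d → ℤ) → ℂ) n = _
  rw [neg_zero, cocycle_zero_left, map_one, Pi.single_apply]

theorem trace_toOp (a : Smooth θ) : trace (toOp a) = coeff a 0 := by
  rw [trace, inner_basisVec_left, ← fc_toOp, fc]

theorem ofOp_smul_one_apply (c : ℂ) (a : Smooth θ) :
    ofOp θ (c • (1 : Op d)) a = c * coeff a 0 := by
  rw [ofOp_apply, smul_mul_assoc, one_mul, trace_smul, trace_toOp]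

/-- On a test element, `sum_mul_poincareSymbol` recovers `a` minus its mean. The minus sign in the
symbol cancels the one in the definition of a distributional derivative. -/
theorem sub_mean_eq_sum (F : Distribution θ) :
    F - ofOp θ (fourierCoeff F 0 • (1 : Op d)) =
      ∑ j, mulD (poincareSymbol j) (isMultiplier_poincareSymbol j)
        (deriv (Pi.single j 1) F) := by
  ext a
  have h1 : a - coeff a 0 • monoStar θ 0 =
      ∑ j, -derivS (Pi.single j 1) (mulS (poincareSymbol j) (isMultiplier_poincareSymbol j) a) := by
    refine smooth_ext fun n => ?_
    have h2 := congrArg (· * coeff a n) (sum_mul_poincareSymbol n)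
    simp only [Finset.sum_mul] at h2
    have h3 : ∀ j : Fin d, ∏ i, (2 * Real.pi * Complex.I * (n i : ℂ)) ^ (Pi.single j 1 : Fin d → ℕ) i =
        2 * Real.pi * Complex.I * (n j : ℂ) := fun j => by
      rw [Finset.prod_eq_single j]
      · simp
      · intro i _ hi
        simp [hi]
      · simp
    rw [map_sub, map_smul, map_sum, Pi.sub_apply, Pi.smul_apply, Finset.sum_apply,
      coeff_monoStar_zero]
    simp only [map_neg, Pi.neg_apply, coeff_derivS, coeff_mulS, h3, Finset.sum_neg_distrib,
      ← mul_assoc, h2]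
    split_ifs with h
    · simp [h]
    · simp
  rw [sub_apply, sum_apply, ofOp_smul_one_apply]
  have h2 := congrArg F h1
  rw [map_sub, map_smul, map_sum] at h2
  rw [fourierCoeff, mul_comm]
  refine h2.trans (Finset.sum_congr rfl fun j _ => ?_)
  rw [mulD_apply, deriv_apply, map_neg]
  simp

theorem lpNorm_sub_mean_le {p : ℝ≥0∞} (hp : 1 ≤ p) (F : Distribution θ) :
    lpNorm p (F - ofOp θ (fourierCoeff F 0 • (1 : Op d))) ≤
      ∑ j, lpNorm p (deriv (Pi.single j 1) F) := by
  rw [sub_mean_eq_sum]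
  refine (lpNorm_sum_le hp _ _).trans (Finset.sum_le_sum fun j _ => ?_)
  exact lpNorm_mulD_le hp _ (isMultiplier_poincareSymbol_neg j) _

/-! ### Derivatives of distributions -/

theorem deriv_add_index (m l : Fin d → ℕ) (F : Distribution θ) :
    deriv (m + l) F = deriv l (deriv m F) := by
  ext a
  rw [deriv_apply, deriv_apply, deriv_apply, derivS_add, LinearMap.comp_apply]
  simp only [Pi.add_apply, Finset.sum_add_distrib, pow_add]
  ring

theorem derivS_zero (a : Smooth θ) : derivS 0 a = a := smooth_ext fun n => by
  simp [coeff_derivS]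

theorem deriv_zero_index (F : Distribution θ) : deriv 0 F = F := by
  ext a
  rw [deriv_apply, derivS_zero]
  simp

theorem deriv_add (m : Fin d → ℕ) (F G : Distribution θ) :
    deriv m (F + G) = deriv m F + deriv m G := by
  ext a
  exact mul_add _ _ _

theorem deriv_sub (m : Fin d → ℕ) (F G : Distribution θ) :
    deriv m (F - G) = deriv m F - deriv m G := by
  ext a
  exact mul_sub _ _ _

theorem deriv_smul (m : Fin d → ℕ) (c : ℂ) (F : Distribution θ) :
    deriv m (c • F) = c • deriv m F := by
  ext a
  exact mul_left_comm _ _ _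

theorem deriv_zero (m : Fin d → ℕ) : deriv m (0 : Distribution θ) = 0 := by
  ext a
  exact mul_zero _

theorem prod_zero_index {m : Fin d → ℕ} (hm : m ≠ 0) :
    ∏ j, (2 * Real.pi * Complex.I * ((0 : Fin d → ℤ) j : ℂ)) ^ m j = 0 := by
  obtain ⟨j, hj⟩ := Function.ne_iff.1 hm
  exact Finset.prod_eq_zero (Finset.mem_univ j) (by simpa using hj)

theorem fourierCoeff_deriv_zero {m : Fin d → ℕ} (hm : m ≠ 0) (F : Distribution θ) :
    fourierCoeff (deriv m F) 0 = 0 := by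
  have h : derivS m (monoStar θ 0) = 0 := smooth_ext fun n => by
    rw [coeff_derivS, coeff_monoStar_zero]
    split_ifs with hn
    · rw [hn, prod_zero_index hm, zero_mul]
      rfl
    · rw [mul_zero]
      rfl
  rw [fourierCoeff, deriv_apply, h, map_zero, mul_zero]

theorem deriv_ofOp_smul_one {m : Fin d → ℕ} (hm : m ≠ 0) (c : ℂ) :
    deriv m (ofOp θ (c • (1 : Op d))) = 0 := by
  ext a
  rw [deriv_apply, ofOp_smul_one_apply, coeff_derivS, prod_zero_index hm, zero_mul, mul_zero,
    mul_zero]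
  rfl

theorem lpNorm_le_of_mean_zero {p : ℝ≥0∞} (hp : 1 ≤ p) {F : Distribution θ}
    (hF : fourierCoeff F 0 = 0) : lpNorm p F ≤ ∑ j, lpNorm p (deriv (Pi.single j 1) F) := by
  have h := lpNorm_sub_mean_le hp F
  rwa [hF, zero_smul, ofOp_zero, sub_zero] at h

/-- Each application of the first-order inequality raises the order by one in `d` directions, and
each direction is bounded by the full sum over the top order: hence `d ^ r`. -/
theorem lpNorm_deriv_le {p : ℝ≥0∞} (hp : 1 ≤ p) {F : Distribution θ}
    (hF : fourierCoeff F 0 = 0) (r : ℕ) (m : Fin d → ℕ) :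
    lpNorm p (deriv m F) ≤
      (d : ℝ≥0∞) ^ r * ∑ l ∈ indicesEq d (∑ j, m j + r), lpNorm p (deriv l F) := by
  induction r generalizing m with
  | zero =>
    rw [pow_zero, one_mul]
    exact Finset.single_le_sum (f := fun l => lpNorm p (deriv l F)) (fun _ _ => zero_le)
      ((mem_indicesEq m).2 rfl)
  | succ r ih =>
    -- The hypothesis on the mean is needed only for `m = 0`; proper derivatives always have mean
    -- zero.
    have h0 : fourierCoeff (deriv m F) 0 = 0 := by
      by_cases hm : m = 0
      · rw [hm, deriv_zero_index, hF]
      · exact fourierCoeff_deriv_zero hm F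
    refine (lpNorm_le_of_mean_zero hp h0).trans ?_
    have h1 : ∀ j : Fin d, lpNorm p (deriv (Pi.single j 1) (deriv m F)) ≤
        (d : ℝ≥0∞) ^ r * ∑ l ∈ indicesEq d (∑ j, m j + (r + 1)), lpNorm p (deriv l F) := by
      intro j
      rw [← deriv_add_index]
      have h2 : ∑ i, (m + Pi.single j 1 : Fin d → ℕ) i + r = ∑ i, m i + (r + 1) := by
        simp only [Pi.add_apply, Finset.sum_add_distrib, Finset.sum_pi_single', Finset.mem_univ,
          if_true]
        ring
      have h3 := ih (m + Pi.single j 1)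
      rwa [h2] at h3
    refine (Finset.sum_le_sum fun j _ => h1 j).trans (le_of_eq ?_)
    rw [Finset.sum_const, Finset.card_univ, Fintype.card_fin, nsmul_eq_mul, pow_succ]
    ring

/-! ### Finite `ℓ_p`-norms -/

section

variable {ι : Type*} {p : ℝ≥0∞}

theorem sum_rpow_le_rpow_sum {r : ℝ} (hr : 1 ≤ r) (s : Finset ι) (c : ι → ℝ≥0∞) :
    ∑ m ∈ s, c m ^ r ≤ (∑ m ∈ s, c m) ^ r := by
  classical
  induction s using Finset.induction_on with
  | empty => simp
  | insert i s hi ih =>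
    rw [Finset.sum_insert hi, Finset.sum_insert hi]
    exact (add_le_add le_rfl ih).trans (ENNReal.add_rpow_le_rpow_add _ _ hr)

theorem finiteLp_le_sum (hp : 1 ≤ p) (s : Finset ι) (c : ι → ℝ≥0∞) :
    finiteLp p s c ≤ ∑ m ∈ s, c m := by
  rw [finiteLp]
  split_ifs with h
  · exact Finset.sup_le fun m hm => Finset.single_le_sum (fun _ _ => zero_le) hm
  · have hr := one_le_toReal hp h
    have hr0 : p.toReal ≠ 0 := by positivity
    refine (ENNReal.rpow_le_rpow (sum_rpow_le_rpow_sum hr s c) (by positivity)).trans ?_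
    rw [← ENNReal.rpow_mul, mul_one_div_cancel hr0, ENNReal.rpow_one]

theorem le_finiteLp (hp : 1 ≤ p) {s : Finset ι} (c : ι → ℝ≥0∞) {m : ι} (hm : m ∈ s) :
    c m ≤ finiteLp p s c := by
  rw [finiteLp]
  split_ifs with h
  · exact Finset.le_sup hm
  · have hr := one_le_toReal hp h
    have hr0 : p.toReal ≠ 0 := by positivity
    calc c m = (c m ^ p.toReal) ^ (1 / p.toReal) := by
          rw [← ENNReal.rpow_mul, mul_one_div_cancel hr0, ENNReal.rpow_one]
      _ ≤ _ := ENNReal.rpow_le_rpow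
          (Finset.single_le_sum (f := fun m => c m ^ p.toReal) (fun _ _ => zero_le) hm)
          (by positivity)

theorem sum_le_finiteLp (hp : 1 ≤ p) (s : Finset ι) (c : ι → ℝ≥0∞) :
    ∑ m ∈ s, c m ≤ s.card * finiteLp p s c := by
  rw [← nsmul_eq_mul]
  exact Finset.sum_le_card_nsmul _ _ _ fun m hm => le_finiteLp hp c hm

theorem finiteLp_mono_set {s t : Finset ι} (hst : s ⊆ t) (c : ι → ℝ≥0∞) :
    finiteLp p s c ≤ finiteLp p t c := by
  rw [finiteLp, finiteLp]
  split_ifs with h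
  · exact Finset.sup_mono hst
  · exact ENNReal.rpow_le_rpow (Finset.sum_le_sum_of_subset hst) (by positivity)

theorem finiteLp_mono {s : Finset ι} {b c : ι → ℝ≥0∞} (h : ∀ m ∈ s, b m ≤ c m) :
    finiteLp p s b ≤ finiteLp p s c := by
  rw [finiteLp, finiteLp]
  split_ifs
  · exact Finset.sup_mono_fun h
  · refine ENNReal.rpow_le_rpow (Finset.sum_le_sum fun m hm => ?_) (by positivity)
    exact ENNReal.rpow_le_rpow (h m hm) ENNReal.toReal_nonneg

theorem finiteLp_add_le (hp : 1 ≤ p) (s : Finset ι) (b c : ι → ℝ≥0∞) :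
    finiteLp p s (fun m => b m + c m) ≤ finiteLp p s b + finiteLp p s c := by
  simp only [finiteLp]
  split_ifs with h
  · exact Finset.sup_le fun m hm => add_le_add (Finset.le_sup hm) (Finset.le_sup hm)
  · exact ENNReal.Lp_add_le s b c (one_le_toReal hp h)

theorem finiteLp_const_mul (hp : 1 ≤ p) (s : Finset ι) (a : ℝ≥0∞) (c : ι → ℝ≥0∞) :
    finiteLp p s (fun m => a * c m) = a * finiteLp p s c := by
  simp only [finiteLp]
  split_ifs with h
  · exact (Finset.apply_sup_eq_sup_comp_of_linearOrder (a * ·) (fun _ _ h => mul_le_mul_right h a)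
      (mul_zero a)).symm
  · have hr := one_le_toReal hp h
    have hr0 : p.toReal ≠ 0 := by positivity
    simp only [ENNReal.mul_rpow_of_nonneg _ _ ENNReal.toReal_nonneg, ← Finset.mul_sum]
    rw [ENNReal.mul_rpow_of_nonneg _ _ (by positivity), ← ENNReal.rpow_mul,
      mul_one_div_cancel hr0, ENNReal.rpow_one]

theorem finiteLp_lt_top (hp : 1 ≤ p) {s : Finset ι} {c : ι → ℝ≥0∞} (h : ∀ m ∈ s, c m < ∞) :
    finiteLp p s c < ∞ :=
  (finiteLp_le_sum hp s c).trans_lt (ENNReal.sum_lt_top.2 h)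

end

/-! ### Sobolev norms -/

theorem lpNorm_deriv_le_sobolevSeminorm {p : ℝ≥0∞} (hp : 1 ≤ p) {F : Distribution θ}
    (hF : fourierCoeff F 0 = 0) {k : ℕ} {m : Fin d → ℕ} (hm : ∑ j, m j ≤ k) :
    lpNorm p (deriv m F) ≤
      (d : ℝ≥0∞) ^ (k - ∑ j, m j) * ((indicesEq d k).card * sobolevSeminorm p k F) := by
  have h := lpNorm_deriv_le hp hF (k - ∑ j, m j) m
  rw [Nat.add_sub_cancel' hm] at h
  exact h.trans (mul_le_mul_right (sum_le_finiteLp hp _ _) _)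

theorem sobolevSeminorm_le_sobolevNorm (p : ℝ≥0∞) (k : ℕ) (F : Distribution θ) :
    sobolevSeminorm p k F ≤ sobolevNorm p k F :=
  finiteLp_mono_set (Finset.filter_subset _ _) _

theorem sobolevSeminorm_add_le {p : ℝ≥0∞} (hp : 1 ≤ p) (k : ℕ) (F G : Distribution θ) :
    sobolevSeminorm p k (F + G) ≤ sobolevSeminorm p k F + sobolevSeminorm p k G := by
  refine (finiteLp_mono fun m _ => ?_).trans (finiteLp_add_le hp _ _ _)
  rw [deriv_add]
  exact lpNorm_add_le hp _ _

theorem sobolevSeminorm_smul {p : ℝ≥0∞} (hp : 1 ≤ p) (k : ℕ) (c : ℂ) (F : Distribution θ) :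
    sobolevSeminorm p k (c • F) = ‖c‖ₑ * sobolevSeminorm p k F := by
  rw [sobolevSeminorm, sobolevSeminorm, ← finiteLp_const_mul hp]
  simp only [deriv_smul, lpNorm_smul hp]

theorem sobolevSeminorm_zero {p : ℝ≥0∞} (hp : 1 ≤ p) (k : ℕ) :
    sobolevSeminorm p k (0 : Distribution θ) = 0 := by
  have h := sobolevSeminorm_smul hp k 0 (0 : Distribution θ)
  rwa [zero_smul ℂ (0 : Distribution θ), enorm_zero, zero_mul] at h

/-- Derivatives of order at least one annihilate constants. -/
theorem sobolevSeminorm_sub_mean {p : ℝ≥0∞} {k : ℕ} (hk : 1 ≤ k) (c : ℂ) (F : Distribution θ) :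
    sobolevSeminorm p k (F - ofOp θ (c • (1 : Op d))) = sobolevSeminorm p k F := by
  have h : ∀ m ∈ indicesEq d k,
      deriv m (F - ofOp θ (c • (1 : Op d))) = deriv m F := fun m hm => by
    have hm0 : m ≠ 0 := by
      rintro rfl
      have := (mem_indicesEq _).1 hm
      simp at this
      omega
    rw [deriv_sub, deriv_ofOp_smul_one hm0, sub_zero]
  exact le_antisymm (finiteLp_mono fun m hm => by rw [h m hm])
    (finiteLp_mono fun m hm => by rw [h m hm])

theorem fourierCoeff_sub_mean (F : Distribution θ) :
    fourierCoeff (F - ofOp θ (fourierCoeff F 0 • (1 : Op d))) 0 = 0 := by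
  change F (monoStar θ 0) - ofOp θ (fourierCoeff F 0 • (1 : Op d)) (monoStar θ 0) = 0
  rw [ofOp_smul_one_apply, coeff_monoStar_zero, if_pos rfl, mul_one, fourierCoeff, sub_self]

theorem lpNorm_ofOp_smul_one_le {p : ℝ≥0∞} (hp : 1 ≤ p) (c : ℂ) :
    lpNorm p (ofOp θ (c • (1 : Op d))) ≤ ‖c‖ₑ := by
  refine (lpNorm_ofOp_le hp (smul_mem_torus c (one_mem (torus θ)))).trans (le_of_eq ?_)
  rw [pNorm_smul hp (one_mem (torus θ)), pNorm_one, mul_one]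

theorem toOp_monoStar_zero : toOp (monoStar θ 0) = 1 := by
  rw [toOp_monoStar, mono_zero, star_one]

theorem enorm_fourierCoeff_le {p : ℝ≥0∞} (hp : 1 ≤ p) (F : Distribution θ) :
    ‖fourierCoeff F 0‖ₑ ≤ lpNorm p F := by
  have h := enorm_apply_le hp F (monoStar θ 0)
  rwa [toOp_monoStar_zero, ← pNorm_top, pNorm_one, mul_one] at h

theorem enorm_fourierCoeff_le_sobolevNorm {p : ℝ≥0∞} (hp : 1 ≤ p) (k : ℕ) (F : Distribution θ) :
    ‖fourierCoeff F 0‖ₑ ≤ sobolevNorm p k F := by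
  have h := le_finiteLp hp (s := indicesLE d k) (fun m => lpNorm p (deriv m F))
    ((mem_indicesLE 0).2 (by simp))
  rw [deriv_zero_index] at h
  exact (enorm_fourierCoeff_le hp F).trans h

theorem add_mem_Lp {p : ℝ≥0∞} (hp : 1 ≤ p) {F G : Distribution θ} (hF : F ∈ Lp θ p)
    (hG : G ∈ Lp θ p) : F + G ∈ Lp θ p := by
  obtain ⟨x, hx⟩ := hF
  obtain ⟨y, hy⟩ := hG
  exact ⟨_, hx.add hp hy⟩

theorem smul_mem_Lp {p : ℝ≥0∞} (hp : 1 ≤ p) (c : ℂ) {F : Distribution θ} (hF : F ∈ Lp θ p) :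
    c • F ∈ Lp θ p := by
  obtain ⟨x, hx⟩ := hF
  exact ⟨_, hx.smul hp c⟩

theorem zero_mem_Lp {p : ℝ≥0∞} (hp : 1 ≤ p) : (0 : Distribution θ) ∈ Lp θ p := by
  rw [← ofOp_zero]
  exact ⟨_, representsLp_const hp ⟨0, zero_mem _⟩⟩

theorem isNormOn_sobolev {p : ℝ≥0∞} (hp : 1 ≤ p) (k : ℕ) :
    IsNormOn (Sobolev θ p k) fun x => ‖fourierCoeff x 0‖ₑ + sobolevSeminorm p k x where
  zero_mem m _ := by
    rw [deriv_zero]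
    exact zero_mem_Lp hp
  add_mem x hx y hy m hm := by
    rw [deriv_add]
    exact add_mem_Lp hp (hx m hm) (hy m hm)
  smul_mem c x hx m hm := by
    rw [deriv_smul]
    exact smul_mem_Lp hp c (hx m hm)
  lt_top x hx := ENNReal.add_lt_top.2 ⟨enorm_lt_top, finiteLp_lt_top hp fun m hm =>
    lpNorm_lt_top hp (hx m ((mem_indicesEq m).1 hm).le)⟩
  eq_zero_iff x hx := by
    constructor
    · intro h
      obtain ⟨h1, h2⟩ := add_eq_zero.1 h
      -- Definiteness is the Poincaré inequality of order `k` itself: mean zero and zero seminorm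
      -- force `‖x‖_p = 0`.
      have h3 := lpNorm_deriv_le_sobolevSeminorm hp (enorm_eq_zero.1 h1) (k := k) (m := 0)
        (by simp)
      rw [h2, mul_zero, mul_zero, nonpos_iff_eq_zero, deriv_zero_index] at h3
      exact eq_zero_of_lpNorm_eq_zero hp h3
    · rintro rfl
      rw [sobolevSeminorm_zero hp, add_zero, enorm_eq_zero]
      rfl
  add_le x _ y _ := by
    refine (add_le_add (enorm_add_le _ _) (sobolevSeminorm_add_le hp k x y)).trans (le_of_eq ?_)
    exact add_add_add_comm _ _ _ _
  smul_eq c x _ := by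
    rw [sobolevSeminorm_smul hp, mul_add, ← enorm_mul]
    rfl

theorem sobolevSeminorm_le {p : ℝ≥0∞} (hp : 1 ≤ p) {j k : ℕ} (hjk : j ≤ k) {F : Distribution θ}
    (hF : fourierCoeff F 0 = 0) :
    sobolevSeminorm p j F ≤
      ((indicesEq d j).card * (d : ℝ≥0∞) ^ (k - j) * (indicesEq d k).card) *
        sobolevSeminorm p k F := by
  refine (finiteLp_le_sum hp _ _).trans ((Finset.sum_le_card_nsmul _ _
    ((d : ℝ≥0∞) ^ (k - j) * ((indicesEq d k).card * sobolevSeminorm p k F))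
    fun m hm => ?_).trans (le_of_eq ?_))
  · have hm' := (mem_indicesEq m).1 hm
    have h := lpNorm_deriv_le_sobolevSeminorm hp hF (hm'.trans_le hjk)
    rwa [hm'] at h
  · rw [nsmul_eq_mul]
    ring

/-- Split `F` into its mean and the mean-zero part `G`. The derivatives of `G` are controlled by the
top-order seminorm, which `F` and `G` share; the constant contributes only for `m = 0`. -/
theorem sobolevNorm_le (hd : 1 ≤ d) {p : ℝ≥0∞} (hp : 1 ≤ p) {k : ℕ} (hk : 1 ≤ k)
    (F : Distribution θ) :
    sobolevNorm p k F ≤ ((indicesLE d k).card * ((d : ℝ≥0∞) ^ k * (indicesEq d k).card + 1)) *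
      (‖fourierCoeff F 0‖ₑ + sobolevSeminorm p k F) := by
  set c := fourierCoeff F 0 with hc
  set G := F - ofOp θ (c • (1 : Op d)) with hG
  -- Needed to enlarge the exponent `k - |m|` to `k`, uniformly in `m`.
  have hd' : (1 : ℝ≥0∞) ≤ d := by exact_mod_cast hd
  have h1 : ∀ m ∈ indicesLE d k, lpNorm p (deriv m F) ≤
      ((d : ℝ≥0∞) ^ k * (indicesEq d k).card + 1) * (‖c‖ₑ + sobolevSeminorm p k F) := by
    intro m hm
    have h2 : lpNorm p (deriv m G) ≤
        (d : ℝ≥0∞) ^ k * (indicesEq d k).card * sobolevSeminorm p k F := by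
      refine (lpNorm_deriv_le_sobolevSeminorm hp (fourierCoeff_sub_mean F)
        ((mem_indicesLE m).1 hm)).trans ?_
      rw [sobolevSeminorm_sub_mean hk, mul_assoc]
      gcongr
      omega
    have h3 : lpNorm p (deriv m F) ≤ lpNorm p (deriv m G) + ‖c‖ₑ := by
      have h4 : deriv m F = deriv m G + deriv m (ofOp θ (c • (1 : Op d))) := by
        rw [← deriv_add, hG, sub_add_cancel]
      rw [h4]
      refine (lpNorm_add_le hp _ _).trans (add_le_add le_rfl ?_)
      by_cases hm0 : m = 0
      · rw [hm0, deriv_zero_index]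
        exact lpNorm_ofOp_smul_one_le hp c
      · rw [deriv_ofOp_smul_one hm0, lpNorm_zero hp]
        exact zero_le
    refine h3.trans ((add_le_add h2 le_rfl).trans ?_)
    rw [add_mul, one_mul]
    exact add_le_add (mul_le_mul_right le_add_self _) le_self_add
  refine (finiteLp_le_sum hp _ _).trans ((Finset.sum_le_card_nsmul _ _ _ h1).trans (le_of_eq ?_))
  rw [nsmul_eq_mul, mul_assoc]

theorem lpNorm_sub_mean_le_sobolevSeminorm {p : ℝ≥0∞} (hp : 1 ≤ p) (F : Distribution θ) :
    lpNorm p (F - ofOp θ (fourierCoeff F 0 • (1 : Op d))) ≤ d * sobolevSeminorm p 1 F := by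
  refine (lpNorm_sub_mean_le hp F).trans ((Finset.sum_le_card_nsmul _ _ (sobolevSeminorm p 1 F)
    fun j _ => ?_).trans (le_of_eq ?_))
  · exact le_finiteLp hp (fun m => lpNorm p (deriv m F)) ((mem_indicesEq _).2 (by simp))
  · rw [Finset.card_univ, Fintype.card_fin, nsmul_eq_mul]

end

end QuantumTorus

/-! ### The theorem, with explicit constants -/

theorem mainTheorem3 {d : ℕ} (hd : 2 ≤ d) :
    (∃ C : ℝ≥0, ∀ (θ : Matrix (Fin d) (Fin d) ℝ), θᵀ = -θ → ∀ p : ℝ≥0∞, 1 ≤ p →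
      ∀ x ∈ QuantumTorus.Sobolev θ p 1,
        QuantumTorus.lpNorm p
            (x - QuantumTorus.ofOp θ (QuantumTorus.fourierCoeff x 0 • 1)) ≤
          C * QuantumTorus.sobolevSeminorm p 1 x) ∧
    (∀ j k : ℕ, j < k →
      ∃ C : ℝ≥0, ∀ (θ : Matrix (Fin d) (Fin d) ℝ), θᵀ = -θ → ∀ p : ℝ≥0∞, 1 ≤ p →
        ∀ x ∈ QuantumTorus.Sobolev θ p k, QuantumTorus.fourierCoeff x 0 = 0 →
          QuantumTorus.sobolevSeminorm p j x ≤ C * QuantumTorus.sobolevSeminorm p k x) ∧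
    (∀ k : ℕ, 1 ≤ k →
      (∀ (θ : Matrix (Fin d) (Fin d) ℝ), θᵀ = -θ → ∀ p : ℝ≥0∞, 1 ≤ p →
        QuantumTorus.IsNormOn (QuantumTorus.Sobolev θ p k)
          fun x => ‖QuantumTorus.fourierCoeff x 0‖ₑ + QuantumTorus.sobolevSeminorm p k x) ∧
      ∃ C : ℝ≥0, ∀ (θ : Matrix (Fin d) (Fin d) ℝ), θᵀ = -θ → ∀ p : ℝ≥0∞, 1 ≤ p →
        ∀ x ∈ QuantumTorus.Sobolev θ p k,
          ‖QuantumTorus.fourierCoeff x 0‖ₑ + QuantumTorus.sobolevSeminorm p k x ≤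
            C * QuantumTorus.sobolevNorm p k x ∧
          QuantumTorus.sobolevNorm p k x ≤
            C * (‖QuantumTorus.fourierCoeff x 0‖ₑ + QuantumTorus.sobolevSeminorm p k x)) := by
  refine ⟨⟨d, fun θ _ p hp x _ => ?_⟩, fun j k hjk => ⟨(QuantumTorus.indicesEq d j).card *
    (d : ℝ≥0) ^ (k - j) * (QuantumTorus.indicesEq d k).card, fun θ _ p hp x _ hx => ?_⟩,
    fun k hk => ⟨fun θ _ p hp => QuantumTorus.isNormOn_sobolev hp k,
    -- One constant for both directions: the summand `2` serves the upper bound by the full norm,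
    -- the rest is the constant of `sobolevNorm_le`.
    (QuantumTorus.indicesLE d k).card * ((d : ℝ≥0) ^ k * (QuantumTorus.indicesEq d k).card + 1) + 2,
    fun θ _ p hp x _ => ⟨?_, ?_⟩⟩⟩
  · exact QuantumTorus.lpNorm_sub_mean_le_sobolevSeminorm hp x
  · have h := QuantumTorus.sobolevSeminorm_le hp hjk.le hx
    exact_mod_cast h
  · refine (add_le_add (QuantumTorus.enorm_fourierCoeff_le_sobolevNorm hp k x)
      (QuantumTorus.sobolevSeminorm_le_sobolevNorm p k x)).trans ?_
    rw [← two_mul]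
    refine mul_le_mul_left ?_ _
    push_cast
    exact le_add_self
  · refine (QuantumTorus.sobolevNorm_le (by omega) hp hk x).trans (mul_le_mul_left ?_ _)
    push_cast
    exact le_self_add
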